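/- Let $\mathbf D\subset\mathbb C$ be the open unit disk, and let $L^\infty(\partial\mathbf D)$ be the space of essentially bounded complex functions on the unit circle with respect to arc length, with the essential supremum norm. For $t_0\in\mathbb R$, $k\in\{-1,1\}$ and $0<s\le 2\pi$ let $\gamma_{t_0^k}(s):=\{e^{i(t_0+kt)}: 0<t<s\}$. A continuous function $f:\mathbb R\to\mathbb C$ is almost periodic if for every $\epsilon>0$ there is $l>0$ such that every interval $[a,a+l]$, $a\in\mathbb R$, contains a number $\tau$ with $|f(t)-f(t+\tau)|<\epsilon$ for all $t\in\mathbb R$. A continuous function $f_k:\gamma_{t_0^k}(s)\to\mathbb C$ is almost periodic if the function $t\mapsto f_k(e^{i(t_0+kse^t)})$ on $(-\infty,0)$ is the restriction of an almost periodic function on $\mathbb R$. Let $AP(\partial\mathbf D)$ be the set of all $f\in L^\infty(\partial\mathbf D)$ such that for every $t_0\in\mathbb R$ and every $\epsilon>0$ there are $s\in(0,\pi)$ and almost periodic functions $f_k:\gamma_{t_0^k}(s)\to\mathbb C$, $k\in\{-1,1\}$, with $$\operatorname*{ess\,sup}_{z\in\gamma_{t_0^k}(s)}|f(z)-f_k(z)|<\epsilon,\qquad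 k\in\{-1,1\}.$$ For a nonempty closed set $S\subset\partial\mathbf D$ let $AP(S)$ be the set of those $f\in AP(\partial\mathbf D)$ that are continuous on $\partial\mathbf D\setminus S$, that is, that agree almost everywhere with a function whose restriction to $\partial\mathbf D\setminus S$ is continuous. Fix a continuous function $g:\partial\mathbf D\setminus\{1\}\to\mathbb R$ such that $t\mapsto g(e^{it})$ is strictly decreasing on $(0,2\pi)$, $\lim_{t\to0+}g(e^{it})=1$ and $\lim_{t\to2\pi-}g(e^{it})=0$. For $t_0\in\mathbb R$, $k\in\{-1,1\}$ and $0<t<2\pi$ put $$g_{t_0}(e^{i(t_0+t)}):=g(e^{it}),\qquad \log_{t_0^k}(e^{i(t_0+kt)}):=\ln t .$$ **Theorem.** For every nonempty closed set $S\subset\partial\mathbf D$, $AP(S)$ is the closure in $L^\infty(\partial\mathbf D)$ of the algebra of complex polynomials in the functions $g_{t_0}$ and $e^{i\lambda\log_{t_0^k}}$, where $\lambda\in\mathbb R$, $e^{it_0}\in S$ and $k\in\{-1,1\}$. -/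

import Mathlib

open Set Filter Topology MeasureTheory

namespace CircleAP

/-! ### The unit circle with arc length, and `L^∞` -/

noncomputable instance instMeasurableSpaceCircle : MeasurableSpace Circle := borel Circle

instance instBorelSpaceCircle : BorelSpace Circle := ⟨rfl⟩

/-- Arc length measure on the unit circle. -/
noncomputable def arcLength : Measure Circle :=
  Measure.map Circle.exp (volume.restrict (Ioc 0 (2 * Real.pi)))

/-- The Banach space `L^∞` of the unit circle, with the essential supremum norm. -/
abbrev LInfty : Type := Lp ℂ ⊤ arcLength

/-! ### Almost periodic functions on the line and on open arcs -/

/-- Bohr almost periodic functions on the real line. -/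
def IsAlmostPeriodic (f : ℝ → ℂ) : Prop :=
  Continuous f ∧ ∀ ε > 0, ∃ l > 0, ∀ t₀ : ℝ, ∃ τ ∈ Icc t₀ (t₀ + l), ∀ t : ℝ, ‖f t - f (t + τ)‖ < ε

/-- The point `e^{i(t₀ + kt)}`. The units of `ℤ` are exactly `1` and `-1`. -/
noncomputable def pt (t₀ : ℝ) (k : ℤˣ) (t : ℝ) : Circle :=
  Circle.exp (t₀ + ((k : ℤ) : ℝ) * t)

/-- The open arc `{e^{i(t₀ + kt)} : 0 < t < s}`. -/
def arc (t₀ : ℝ) (k : ℤˣ) (s : ℝ) : Set Circle :=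
  pt t₀ k '' Ioo 0 s

/-- Almost periodicity of a function on the arc `arc t₀ k s`
(the values outside the arc play no role). -/
def IsAlmostPeriodicOnArc (t₀ : ℝ) (k : ℤˣ) (s : ℝ) (f : Circle → ℂ) : Prop :=
  ContinuousOn f (arc t₀ k s) ∧
    ∃ h : ℝ → ℂ, IsAlmostPeriodic h ∧ ∀ t < 0, f (pt t₀ k (s * Real.exp t)) = h t

/-! ### The algebras of almost periodic functions on the circle -/

/-- `AP(∂𝔻)`: near every point of the circle, and on each side of it, the function is
approximated in the essential supremum by an almost periodic function on an arc. -/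
def APCircle : Set LInfty :=
  {f | ∀ t₀ : ℝ, ∀ ε > 0, ∃ s ∈ Ioo 0 Real.pi, ∀ k : ℤˣ, ∃ fk : Circle → ℂ,
    IsAlmostPeriodicOnArc t₀ k s fk ∧
    eLpNormEssSup (fun z => f z - fk z) (arcLength.restrict (arc t₀ k s)) < ENNReal.ofReal ε}

/-- `AP(S)`: the elements of `AP(∂𝔻)` which are continuous off `S`, that is, which have a
representative whose restriction to the complement of `S` is continuous. -/
def AP (S : Set Circle) : Set LInfty :=
  {f | f ∈ APCircle ∧ ∃ F : Circle → ℂ, ContinuousOn F Sᶜ ∧ f =ᵐ[arcLength] F}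

/-! ### The generators -/

/-- A real continuous function `g` on the circle without the point `1` such that `t ↦ g(e^{it})`
decreases strictly on `(0, 2π)`, from the limit `1` at `0+` to the limit `0` at `2π-`. -/
structure IsJumpFunction (g : Circle → ℝ) : Prop where
  continuousOn : ContinuousOn g {1}ᶜ
  tendsto_zero : Tendsto (fun t : ℝ => g (Circle.exp t)) (𝓝[>] 0) (𝓝 1)
  tendsto_two_pi : Tendsto (fun t : ℝ => g (Circle.exp t)) (𝓝[<] (2 * Real.pi)) (𝓝 0)
  strictAntiOn : StrictAntiOn (fun t : ℝ => g (Circle.exp t)) (Ioo 0 (2 * Real.pi))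

theorem IsJumpFunction.norm_le {g : Circle → ℝ} (hg : IsJumpFunction g) (z : Circle) :
    ‖g z‖ ≤ max ‖g 1‖ 1 := by
  by_cases hz : z = 1
  · rw [hz]
    exact le_max_left _ _
  refine le_max_of_le_right ?_
  obtain ⟨t, ht, rfl⟩ : ∃ t ∈ Ioo 0 (2 * Real.pi), Circle.exp t = z := by
    have hmem := toIcoMod_mem_Ico' Real.two_pi_pos (Complex.arg (z : ℂ))
    have hexp : Circle.exp (toIcoMod Real.two_pi_pos 0 (Complex.arg (z : ℂ))) = z := by
      conv_rhs => rw [← Circle.exp_arg z]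
      refine Circle.exp_eq_exp.2 ⟨-toIcoDiv Real.two_pi_pos 0 (Complex.arg (z : ℂ)), ?_⟩
      rw [toIcoMod, zsmul_eq_mul]
      push_cast
      ring
    refine ⟨_, ⟨lt_of_le_of_ne hmem.1 fun h => hz ?_, hmem.2⟩, hexp⟩
    rw [← hexp, ← h, Circle.exp_zero]
  have h1 : g (Circle.exp t) ≤ 1 := by
    refine ge_of_tendsto hg.tendsto_zero ?_
    filter_upwards [Ioo_mem_nhdsGT ht.1] with x hx
    exact (hg.strictAntiOn ⟨hx.1, hx.2.trans ht.2⟩ ht hx.2).le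
  have h0 : 0 ≤ g (Circle.exp t) := by
    refine le_of_tendsto hg.tendsto_two_pi ?_
    filter_upwards [Ioo_mem_nhdsLT ht.2] with x hx
    exact (hg.strictAntiOn ht ⟨ht.1.trans hx.1, hx.2⟩ hx.1).le
  rw [Real.norm_eq_abs, abs_le]
  exact ⟨by linarith, h1⟩

/-- The rotated function `g_{t₀}(e^{i(t₀ + t)}) = g(e^{it})`, with its jump at `e^{it₀}`. -/
noncomputable def jumpAt (g : Circle → ℝ) (t₀ : ℝ) (z : Circle) : ℝ :=
  g (z / Circle.exp t₀)

/-- The function `log_{t₀^k}`: see `logAt_pt`. It takes the value `0` at `e^{it₀}`. -/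
noncomputable def logAt (t₀ : ℝ) (k : ℤˣ) (z : Circle) : ℝ :=
  Real.log (toIcoMod Real.two_pi_pos 0 (((k : ℤ) : ℝ) * (Complex.arg (z : ℂ) - t₀)))

/-- The defining formula `log_{t₀^k}(e^{i(t₀ + kt)}) = ln t` for `0 < t < 2π`. -/
theorem logAt_pt (t₀ : ℝ) (k : ℤˣ) {t : ℝ} (ht : t ∈ Ioo 0 (2 * Real.pi)) :
    logAt t₀ k (pt t₀ k t) = Real.log t := by
  have key : toIcoMod Real.two_pi_pos 0
      (((k : ℤ) : ℝ) * (Complex.arg (pt t₀ k t : ℂ) - t₀)) = t := by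
    have harg : Circle.exp (Complex.arg (pt t₀ k t : ℂ)) = Circle.exp (t₀ + ((k : ℤ) : ℝ) * t) :=
      Circle.exp_arg _
    obtain ⟨m, hm⟩ := Circle.exp_eq_exp.1 harg
    have hk : ((k : ℤ) : ℝ) * ((k : ℤ) : ℝ) = 1 := by
      rcases Int.units_eq_one_or k with rfl | rfl <;> norm_num
    refine (toIcoMod_eq_iff _).2 ⟨⟨ht.1.le, by simpa using ht.2⟩, (k : ℤ) * m, ?_⟩
    rw [hm, zsmul_eq_mul]
    push_cast
    linear_combination t * hk
  rw [logAt, key]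

/-- The oscillating function `e^{iλ log_{t₀^k}}`. -/
noncomputable def expLogAt (lam t₀ : ℝ) (k : ℤˣ) (z : Circle) : ℂ :=
  Complex.exp (Complex.I * (lam : ℂ) * (logAt t₀ k z : ℂ))

/-- The functions `g_{t₀}` and `e^{iλ log_{t₀^k}}` with `λ` real, `e^{it₀} ∈ S` and `k = ±1`. -/
def generators (g : Circle → ℝ) (S : Set Circle) : Set (Circle → ℂ) :=
  {u | ∃ t₀ : ℝ, Circle.exp t₀ ∈ S ∧
    ((u = fun z => (jumpAt g t₀ z : ℂ)) ∨ ∃ (lam : ℝ) (k : ℤˣ), u = expLogAt lam t₀ k)}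

/-- The complex polynomials in the generators, as functions on the circle. -/
noncomputable def polynomials (g : Circle → ℝ) (S : Set Circle) : Subalgebra ℂ (Circle → ℂ) :=
  Algebra.adjoin ℂ (generators g S)

/-- The classes in `L^∞` of the complex polynomials in the generators. -/
def polynomialClasses (g : Circle → ℝ) (S : Set Circle) : Set LInfty :=
  {f | ∃ p ∈ polynomials g S, f =ᵐ[arcLength] p}

/-- Every complex polynomial in the generators defines an element of `L^∞`. -/
theorem memLp_of_mem_polynomials {g : Circle → ℝ} (hg : IsJumpFunction g) (S : Set Circle)
    {p : Circle → ℂ} (hp : p ∈ polynomials g S) : MemLp p ⊤ arcLength := by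
  suffices H : Measurable p ∧ ∃ C : ℝ, ∀ z, ‖p z‖ ≤ C from
    memLp_top_of_bound H.1.aestronglyMeasurable H.2.choose
      (Eventually.of_forall H.2.choose_spec)
  induction hp using Algebra.adjoin_induction with
  | mem u hu =>
    obtain ⟨t₀, -, rfl | ⟨lam, k, rfl⟩⟩ := hu
    · have hm : Measurable g := by
        refine measurable_of_continuousOn_compl_singleton 1 hg.continuousOn
      refine ⟨Complex.measurable_ofReal.comp (hm.comp (continuous_id.div_const _).measurable), ?_⟩
      refine ⟨max ‖g 1‖ 1, fun z => ?_⟩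
      rw [Complex.norm_real, jumpAt]
      exact hg.norm_le _
    · refine ⟨?_, 1, fun z => ?_⟩
      · have h1 : Measurable fun z : Circle => Complex.arg (z : ℂ) :=
          Complex.measurable_arg.comp (show Continuous fun z : Circle => (z : ℂ) from continuous_subtype_val).measurable
        have h2 : Measurable fun x : ℝ => toIcoMod Real.two_pi_pos 0 x := by
          simp only [toIcoMod, toIcoDiv_eq_floor]
          fun_prop
        have h3 : Measurable (logAt t₀ k) :=
          Real.measurable_log.comp (h2.comp ((h1.sub_const _).const_mul _))
        exact Complex.measurable_exp.comp ((Complex.measurable_ofReal.comp h3).const_mul _)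
      · rw [expLogAt, show Complex.I * (lam : ℂ) * (logAt t₀ k z : ℂ)
          = ((lam * logAt t₀ k z : ℝ) : ℂ) * Complex.I by push_cast; ring,
          Complex.norm_exp_ofReal_mul_I]
  | algebraMap r => exact ⟨measurable_const, ‖r‖, fun z => le_rfl⟩
  | add u v _ _ hu hv =>
    obtain ⟨⟨hu, A, hA⟩, hv, B, hB⟩ := And.intro hu hv
    exact ⟨hu.add hv, A + B, fun z => (norm_add_le _ _).trans (add_le_add (hA z) (hB z))⟩
  | mul u v _ _ hu hv =>
    obtain ⟨⟨hu, A, hA⟩, hv, B, hB⟩ := And.intro hu hv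
    refine ⟨hu.mul hv, A * B, fun z => (norm_mul_le _ _).trans ?_⟩
    exact mul_le_mul (hA z) (hB z) (norm_nonneg _) ((norm_nonneg _).trans (hA z))

end CircleAP

/-!
The classes of the polynomials in the generators form an algebra, and a class lies in its closure
exactly when it is an essentially uniform limit of such polynomials (`Approximable`). Both
inclusions rest on the fact that almost periodic functions on the line are the uniform limits of
trigonometric polynomials: since `e^{iλ log t}` is a generator near each point of `S`, a
trigonometric polynomial in `log t` is a polynomial in the generators.

**Bohr's approximation theorem** (`IsAlmostPeriodic.exists_trigPoly`). The almost periods of an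
almost periodic function in a fine lattice are relatively dense, so by Bogolyubov's lemma
(`bogolyubov_int`, deduced from the finite cyclic groups by compactness) sums of four of them fill a
Bohr neighbourhood `{τ | |e^{iλ_j τ} - 1| < η}` of `0`. Hence the function is almost invariant under
a Bohr neighbourhood. Its convolution, with respect to an invariant mean, with a trigonometric
polynomial kernel concentrated on that neighbourhood is a trigonometric polynomial, and is
uniformly close to the function. Conversely, trigonometric polynomials are almost periodic because
orbits in a torus are totally bounded.

**Limits of polynomials belong to `AP S`.** A polynomial in the generators is continuous off `S`,
and near every point, on each side, it is close to a trigonometric polynomial in the logarithm of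
the distance (`LocallyTrig`): this property passes to sums and products, and each generator has it,
being either convergent on the given side or equal to `e^{iλ log t}`. Off the closed set `S`
essentially uniform convergence is uniform, which gives a continuous limit there.

**Elements of `AP S` are limits of polynomials.** A function continuous on the circle except for
a jump at a point of `S` is a limit of polynomials in the jump function at that point, by
Stone–Weierstrass (`approximable_of_comp_pt`); this yields all continuous functions, and cutoffs to
one side of a point of `S`. Near a point of `S` an element of `AP S` is therefore close to an
approximable function, by Bohr's theorem on each side, and near any other point it is close to a
constant. A continuous partition of unity glues these local approximants.
-/

namespace CircleAP

/-! ### Bogolyubov's lemma -/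

lemma norm_sq_sum_addChar {G : Type*} [AddCommGroup G] [Finite G] (B : Finset G) (ψ : AddChar G ℂ) :
    ((‖∑ b ∈ B, ψ b‖ ^ 2 : ℝ) : ℂ) = ∑ a ∈ B, ∑ b ∈ B, ψ (a - b) := by
  rw [← Complex.normSq_eq_norm_sq, ← Complex.mul_conj, map_sum, Finset.sum_mul_sum]
  refine Finset.sum_congr rfl fun a _ => Finset.sum_congr rfl fun b _ => ?_
  rw [sub_eq_add_neg, AddChar.map_add_eq_mul, AddChar.map_neg_eq_conj]

/-- Parseval's identity for the indicator function of `B`. -/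
lemma sum_norm_sq_sum_addChar {G : Type*} [AddCommGroup G] [Fintype G] (B : Finset G) :
    ∑ ψ : AddChar G ℂ, ‖∑ b ∈ B, ψ b‖ ^ 2 = Fintype.card G * B.card := by
  classical
  have h : ((∑ ψ : AddChar G ℂ, ‖∑ b ∈ B, ψ b‖ ^ 2 : ℝ) : ℂ) = Fintype.card G * B.card := by
    rw [Complex.ofReal_sum]
    simp_rw [norm_sq_sum_addChar]
    rw [Finset.sum_comm]
    have : ∀ a ∈ B, ∑ ψ : AddChar G ℂ, ∑ b ∈ B, ψ (a - b) = Fintype.card G := by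
      intro a ha
      rw [Finset.sum_comm]
      simp_rw [AddChar.sum_apply_eq_ite, sub_eq_zero]
      simp [ha]
    rw [Finset.sum_congr rfl this]
    simp [mul_comm]
  exact_mod_cast h

/-- **Bogolyubov's lemma** in a finite abelian group: the set `B + B - B - B` contains every
element at which the large Fourier coefficients of `B` have nonnegative real part. The large
coefficients are those with `2 * |G| * ‖B̂ ψ‖² ≥ |B|³`. -/
lemma bogolyubov_finite {G : Type*} [AddCommGroup G] [Fintype G] (B : Finset G)
    (hB : B.Nonempty) : ∃ Ψ : Finset (AddChar G ℂ), Ψ.card * B.card ^ 2 ≤ 2 * Fintype.card G ^ 2 ∧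
      ∀ x : G, (∀ ψ ∈ Ψ, 0 ≤ (ψ x).re) → ∃ a ∈ B, ∃ b ∈ B, ∃ c ∈ B, ∃ d ∈ B, a + b - c - d = x := by
  classical
  set N : ℝ := (Fintype.card G : ℝ) with hN
  set β : ℝ := (B.card : ℝ) with hβ
  have hβ0 : 0 < β := Nat.cast_pos.2 hB.card_pos
  have hN0 : 0 < N := Nat.cast_pos.2 Fintype.card_pos
  set F : AddChar G ℂ → ℝ := fun ψ => ‖∑ b ∈ B, ψ b‖ ^ 2 with hF
  have hF0 : ∀ ψ, 0 ≤ F ψ := fun ψ => by positivity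
  have hpars : ∑ ψ, F ψ = N * β := sum_norm_sq_sum_addChar B
  refine ⟨Finset.univ.filter fun ψ => β ^ 3 ≤ 2 * N * F ψ, ?_, fun x hx => ?_⟩
  · have h1 : ((Finset.univ.filter fun ψ => β ^ 3 ≤ 2 * N * F ψ).card : ℝ) * β ^ 3 ≤
        2 * N * (N * β) := by
      rw [← hpars, Finset.mul_sum, ← nsmul_eq_mul]
      refine (Finset.card_nsmul_le_sum _ (fun ψ => 2 * N * F ψ) _ fun ψ hψ =>
        (Finset.mem_filter.1 hψ).2).trans ?_
      exact Finset.sum_le_sum_of_subset_of_nonneg (Finset.filter_subset _ _)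
        fun ψ _ _ => by have := hF0 ψ; positivity
    have h2 : ((Finset.univ.filter fun ψ => β ^ 3 ≤ 2 * N * F ψ).card : ℝ) * β ^ 2 ≤
        2 * N ^ 2 := by
      refine le_of_mul_le_mul_right ?_ hβ0
      linarith
    rw [hβ, hN] at h2 ⊢
    exact_mod_cast h2
  · by_contra! hcon
    -- the Fourier expansion of the number of representations of `x`, which vanishes
    have hzero : ∑ ψ : AddChar G ℂ, F ψ ^ 2 * (ψ x).re = 0 := by
      have h : ∑ ψ : AddChar G ℂ, (((F ψ : ℝ) : ℂ)) ^ 2 * ψ x = 0 := by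
        have h1 : ∀ ψ : AddChar G ℂ, (((F ψ : ℝ) : ℂ)) ^ 2 * ψ x =
            ∑ c ∈ B, ∑ a ∈ B, ∑ d ∈ B, ∑ b ∈ B, ψ (c - a + (d - b) + x) := by
          intro ψ
          rw [sq, hF, norm_sq_sum_addChar]
          simp_rw [AddChar.map_add_eq_mul, ← Finset.sum_mul, ← Finset.mul_sum, ← Finset.sum_mul]
        simp_rw [h1]
        rw [Finset.sum_comm]
        refine Finset.sum_eq_zero fun c hc => ?_
        rw [Finset.sum_comm]
        refine Finset.sum_eq_zero fun a ha => ?_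
        rw [Finset.sum_comm]
        refine Finset.sum_eq_zero fun d hd => ?_
        rw [Finset.sum_comm]
        refine Finset.sum_eq_zero fun b hb => ?_
        rw [AddChar.sum_apply_eq_ite, if_neg]
        intro h0
        apply hcon a ha b hb c hc d hd
        rw [← sub_eq_zero, ← neg_eq_zero, ← h0]
        abel
      have := congrArg Complex.re h
      rw [Complex.re_sum, Complex.zero_re] at this
      rw [← this]
      refine Finset.sum_congr rfl fun ψ _ => ?_
      rw [← Complex.ofReal_pow, Complex.re_ofReal_mul]
    have htriv : F 0 = β ^ 2 := by simp [hF, hβ]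
    have hlow : ∀ ψ ∈ (Finset.univ : Finset (AddChar G ℂ)).erase 0,
        -(β ^ 3 / (2 * N) * F ψ) ≤ F ψ ^ 2 * (ψ x).re := by
      intro ψ _
      by_cases hψ : β ^ 3 ≤ 2 * N * F ψ
      · have h1 := hx ψ (by simpa using hψ)
        have h2 := hF0 ψ
        have : 0 ≤ F ψ ^ 2 * (ψ x).re := by positivity
        have : 0 ≤ β ^ 3 / (2 * N) * F ψ := by positivity
        linarith
      · have h1 : F ψ ≤ β ^ 3 / (2 * N) := by
          rw [le_div_iff₀ (by positivity)]; linarith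
        have h2 : -1 ≤ (ψ x).re := by
          have := (Complex.abs_re_le_norm (ψ x)).trans_eq (AddChar.norm_apply ψ x)
          exact (abs_le.1 this).1
        have h3 := hF0 ψ
        nlinarith [mul_le_mul_of_nonneg_right h1 h3,
          mul_nonneg (sq_nonneg (F ψ)) (by linarith : 0 ≤ (ψ x).re + 1)]
    have hsum := Finset.sum_le_sum hlow
    have e1 := Finset.add_sum_erase Finset.univ (fun ψ : AddChar G ℂ => F ψ ^ 2 * (ψ x).re)
      (Finset.mem_univ 0)
    have e2 := Finset.add_sum_erase Finset.univ F (Finset.mem_univ 0)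
    rw [Finset.sum_neg_distrib, ← Finset.mul_sum] at hsum
    rw [hzero] at e1
    simp only [htriv, AddChar.zero_apply, Complex.one_re, mul_one] at e1 e2
    have h4 : β ^ 3 / (2 * N) * (∑ ψ ∈ Finset.univ.erase 0, F ψ) ≤ β ^ 4 / 2 := by
      have : (∑ ψ ∈ Finset.univ.erase 0, F ψ) ≤ N * β := by
        rw [← hpars, ← e2]; nlinarith [sq_nonneg β]
      refine (mul_le_mul_of_nonneg_left this (by positivity)).trans_eq ?_
      field_simp
    have : 0 < β ^ 4 := by positivity
    nlinarith

/-- Bogolyubov's lemma in `ℤ`: if `A` meets every interval of length `L`, then `A + A - A - A`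
contains a Bohr neighbourhood of `0`. -/
lemma bogolyubov_int (A : Set ℤ) (L : ℕ) (hA : ∀ m : ℤ, ∃ a ∈ A, m ≤ a ∧ a < m + L) :
    ∃ (K : ℕ) (θ : Fin K → Circle), ∀ n : ℤ, (∀ j, ‖((θ j ^ n : Circle) : ℂ) - 1‖ < 1) →
      ∃ a ∈ A, ∃ b ∈ A, ∃ c ∈ A, ∃ d ∈ A, n = a + b - c - d := by
  classical
  have hL : 0 < L := by
    obtain ⟨a, -, h1, h2⟩ := hA 0
    omega
  set K := 32 * L ^ 2 with hK
  -- The statement for small `n` follows from the one modulo `N = 4 * L * m`, applied to one point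
  -- of `A` in each of the `m` blocks of length `L` in `[0, L * m)`: a sum `a + b - c - d` of such
  -- points has absolute value less than `N / 2`. The set has density `1 / (4 * L)` in `ZMod N`, so
  -- it has at most `2 * (4 * L) ^ 2` large Fourier coefficients, whatever `m` is.
  have key : ∀ m : ℕ, ∃ θ : Fin K → Circle, ∀ n : ℤ, |n| < 2 * L * (m + 1 : ℕ) →
      (∀ j, ‖((θ j ^ n : Circle) : ℂ) - 1‖ < 1) →
      ∃ a ∈ A, ∃ b ∈ A, ∃ c ∈ A, ∃ d ∈ A, n = a + b - c - d := by
    intro m'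
    set m := m' + 1 with hm
    set N := 4 * L * m with hN
    have : NeZero N := ⟨by positivity⟩
    choose a haA ha1 ha2 using fun i : ℕ => hA (L * i)
    set B : Finset (ZMod N) := (Finset.range m).image fun i => ((a i : ℤ) : ZMod N) with hB
    have hbd : ∀ i < m, 0 ≤ a i ∧ a i < L * m := by
      intro i hi
      have h1 := ha1 i
      have h2 := ha2 i
      refine ⟨le_trans (by positivity) h1, h2.trans_le ?_⟩
      have : (i : ℤ) + 1 ≤ m := by exact_mod_cast hi
      nlinarith
    have hcard : B.card = m := by
      rw [hB, Finset.card_image_of_injOn, Finset.card_range]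
      intro i hi j hj hij
      simp only [Finset.coe_range, Set.mem_Iio] at hi hj
      have h1 : a i = a j := by
        have h2 := (ZMod.intCast_eq_intCast_iff_dvd_sub _ _ _).1 hij
        have h3 := hbd i hi
        have h4 := hbd j hj
        have h5 : a j - a i = 0 := by
          refine Int.eq_zero_of_abs_lt_dvd h2 ?_
          rw [abs_lt, hN]
          push_cast
          constructor <;> nlinarith
        omega
      have := ha1 i; have := ha2 i; have := ha1 j; have := ha2 j
      have h6 : (L : ℤ) * i < L * (j + 1) := by linarith
      have h7 : (L : ℤ) * j < L * (i + 1) := by linarith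
      have hL' : (0 : ℤ) < L := by exact_mod_cast hL
      have := lt_of_mul_lt_mul_left h6 hL'.le
      have := lt_of_mul_lt_mul_left h7 hL'.le
      omega
    obtain ⟨Ψ, hΨ, hrep⟩ := bogolyubov_finite B (Finset.card_pos.1 (by rw [hcard]; positivity))
    have hΨK : Ψ.card ≤ K := by
      rw [hcard, ZMod.card] at hΨ
      have : Ψ.card * m ^ 2 ≤ K * m ^ 2 := by
        refine hΨ.trans_eq ?_
        rw [hN, hK]; ring
      exact Nat.le_of_mul_le_mul_right this (by positivity)
    refine ⟨fun j => if h : (j : ℕ) < Ψ.card then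
      AddChar.circleEquivComplex.symm (Ψ.equivFin.symm ⟨j, h⟩ : AddChar (ZMod N) ℂ) 1 else 1,
      fun n hn hθ => ?_⟩
    obtain ⟨x, hx, y, hy, z, hz, w, hw, hsum⟩ := hrep (n : ZMod N) fun ψ hψ => by
      have h1 := hθ ⟨Ψ.equivFin ⟨ψ, hψ⟩, (Ψ.equivFin ⟨ψ, hψ⟩).2.trans_le hΨK⟩
      simp only [Fin.is_lt, dif_pos, Fin.eta, Equiv.symm_apply_apply] at h1
      have h2 : (((AddChar.circleEquivComplex.symm ψ) 1 ^ n : Circle) : ℂ) = ψ (n : ZMod N) := by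
        rw [← AddChar.map_zsmul_eq_zpow, zsmul_one]
        conv_rhs => rw [← AddChar.circleEquivComplex.apply_symm_apply ψ]
        rfl
      rw [h2] at h1
      have h3 := (abs_le.1 (Complex.abs_re_le_norm (ψ (n : ZMod N) - 1))).1
      rw [Complex.sub_re, Complex.one_re] at h3
      linarith
    simp only [hB, Finset.mem_image, Finset.mem_range] at hx hy hz hw
    obtain ⟨i₁, h1, rfl⟩ := hx
    obtain ⟨i₂, h2, rfl⟩ := hy
    obtain ⟨i₃, h3, rfl⟩ := hz
    obtain ⟨i₄, h4, rfl⟩ := hw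
    refine ⟨_, haA i₁, _, haA i₂, _, haA i₃, _, haA i₄, ?_⟩
    have hsum' : (((a i₁ + a i₂ - a i₃ - a i₄ : ℤ)) : ZMod N) = (n : ZMod N) := by
      push_cast; exact hsum
    have hdvd := (ZMod.intCast_eq_intCast_iff_dvd_sub _ _ _).1 hsum'
    have := hbd _ h1; have := hbd _ h2; have := hbd _ h3; have := hbd _ h4
    have h0 : n - (a i₁ + a i₂ - a i₃ - a i₄) = 0 := by
      refine Int.eq_zero_of_abs_lt_dvd hdvd ?_
      rw [abs_lt] at hn ⊢
      rw [hN]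
      push_cast
      constructor <;> nlinarith
    omega
  choose θ hθ using key
  -- the frequencies for different `m` live in one compact torus and have a limit point
  obtain ⟨θ₀, φ, hφ, hlim⟩ := CompactSpace.tendsto_subseq θ
  refine ⟨K, θ₀, fun n hn => ?_⟩
  have hev : ∀ᶠ m in atTop, ∀ j, ‖((θ (φ m) j ^ n : Circle) : ℂ) - 1‖ < 1 := by
    rw [eventually_all]
    intro j
    have h1 : Tendsto (fun m => θ (φ m) j) atTop (𝓝 (θ₀ j)) := (tendsto_pi_nhds.1 hlim) j
    have h2 : Continuous fun z : Circle => ‖((z ^ n : Circle) : ℂ) - 1‖ :=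
      ((show Continuous fun w : Circle => (w : ℂ) from continuous_subtype_val).comp
        (continuous_zpow n) |>.sub continuous_const).norm
    exact ((h2.tendsto _).comp h1).eventually_lt_const (hn j)
  obtain ⟨m, hm, hmn⟩ := (hev.and (eventually_ge_atTop n.natAbs)).exists
  refine hθ (φ m) n ?_ hm
  have h1 : n.natAbs ≤ φ m := hmn.trans (hφ.id_le m)
  have h2 : (n.natAbs : ℤ) ≤ φ m := by exact_mod_cast h1
  rw [Int.natCast_natAbs] at h2
  have hL' : (1 : ℤ) ≤ L := by exact_mod_cast hL
  push_cast
  have := abs_nonneg n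
  nlinarith

/-! ### Characters and trigonometric polynomials -/

/-- The character `t ↦ e^{iλt}` of the real line. -/
noncomputable def chi (lam : ℝ) : BoundedContinuousFunction ℝ ℂ :=
  BoundedContinuousFunction.ofNormedAddCommGroup
    (fun t : ℝ => Complex.exp (Complex.I * (lam : ℂ) * (t : ℂ))) (by fun_prop) 1 fun t => by
      rw [show Complex.I * (lam : ℂ) * (t : ℂ) = ((lam * t : ℝ) : ℂ) * Complex.I by
        push_cast; ring, Complex.norm_exp_ofReal_mul_I]

lemma chi_apply (lam t : ℝ) : chi lam t = Complex.exp (Complex.I * (lam : ℂ) * (t : ℂ)) := rfl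

lemma norm_chi (lam t : ℝ) : ‖chi lam t‖ = 1 := by
  rw [chi_apply, show Complex.I * (lam : ℂ) * (t : ℂ) = ((lam * t : ℝ) : ℂ) * Complex.I by
    push_cast; ring, Complex.norm_exp_ofReal_mul_I]

lemma chi_add_right (lam s t : ℝ) : chi lam (s + t) = chi lam s * chi lam t := by
  simp only [chi_apply, ← Complex.exp_add]
  push_cast
  ring_nf

lemma chi_add_left (lam mu t : ℝ) : chi (lam + mu) t = chi lam t * chi mu t := by
  simp only [chi_apply, ← Complex.exp_add]
  push_cast
  ring_nf

lemma chi_zero_left (t : ℝ) : chi 0 t = 1 := by simp [chi_apply]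

lemma chi_neg_left (lam t : ℝ) : chi (-lam) t = starRingEnd ℂ (chi lam t) := by
  rw [chi_apply, chi_apply, ← Complex.exp_conj]
  simp

lemma chi_neg_right (lam t : ℝ) : chi lam (-t) = chi (-lam) t := by
  simp [chi_apply]

lemma norm_chi_sub_one (lam s t : ℝ) : ‖chi lam (s - t) - 1‖ = ‖chi lam s - chi lam t‖ := by
  have h : chi lam s - chi lam t = (chi lam (s - t) - 1) * chi lam t := by
    rw [sub_mul, ← chi_add_right, sub_add_cancel, one_mul]
  rw [h, norm_mul, norm_chi, mul_one]

/-- The algebra of trigonometric polynomials `∑ c_λ e^{iλt}` on the real line. -/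
noncomputable def trigPoly : Subalgebra ℂ (BoundedContinuousFunction ℝ ℂ) :=
  Algebra.adjoin ℂ (range chi)

lemma chi_mem_trigPoly (lam : ℝ) : chi lam ∈ trigPoly := Algebra.subset_adjoin ⟨lam, rfl⟩

lemma trigPoly_eq_span : Subalgebra.toSubmodule trigPoly = Submodule.span ℂ (range chi) := by
  refine Algebra.adjoin_eq_span_of_subset ℂ fun u hu => Submodule.subset_span ?_
  induction hu using Submonoid.closure_induction with
  | mem u hu => exact hu
  | one => exact ⟨0, by ext t; simp [chi_zero_left]⟩
  | mul u v _ _ hu hv =>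
    obtain ⟨a, rfl⟩ := hu
    obtain ⟨b, rfl⟩ := hv
    exact ⟨a + b, by ext t; simp [chi_add_left]⟩

/-- The translate `t ↦ u (x + t)`. -/
noncomputable def translate (x : ℝ) (u : BoundedContinuousFunction ℝ ℂ) :
    BoundedContinuousFunction ℝ ℂ :=
  u.compContinuous ⟨fun t => x + t, by fun_prop⟩

lemma translate_apply (x : ℝ) (u : BoundedContinuousFunction ℝ ℂ) (t : ℝ) :
    translate x u t = u (x + t) := rfl

lemma translate_mem_trigPoly (x : ℝ) {q : BoundedContinuousFunction ℝ ℂ} (hq : q ∈ trigPoly) :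
    translate x q ∈ trigPoly := by
  induction hq using Algebra.adjoin_induction with
  | mem u hu =>
    obtain ⟨lam, rfl⟩ := hu
    have : translate x (chi lam) = chi lam x • chi lam := by
      ext t; simp [translate_apply, chi_add_right]
    rw [this]
    exact trigPoly.smul_mem (chi_mem_trigPoly lam) _
  | algebraMap r => exact trigPoly.algebraMap_mem r
  | add u v _ _ hu hv => exact trigPoly.add_mem hu hv
  | mul u v _ _ hu hv => exact trigPoly.mul_mem hu hv

/-- Finitely many translates of a Bohr neighbourhood of `0` cover the line, because the orbit
`t ↦ (e^{iλt})_λ` in a torus is totally bounded. -/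
lemma exists_finset_translates_bohr (Λ : Finset ℝ) {δ : ℝ} (hδ : 0 < δ) :
    ∃ T : Finset ℝ, ∀ t, ∃ a ∈ T, ∀ lam ∈ Λ, ‖chi lam (t - a) - 1‖ < δ := by
  classical
  set Φ : ℝ → Λ → ℂ := fun t lam => chi lam t with hΦ
  have hb : Bornology.IsBounded (range Φ) := by
    refine (Metric.isBounded_closedBall (x := (0 : Λ → ℂ)) (r := 1)).subset ?_
    rintro _ ⟨t, rfl⟩
    rw [mem_closedBall_zero_iff, pi_norm_le_iff_of_nonneg zero_le_one]
    exact fun lam => (norm_chi _ _).le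
  have htb : TotallyBounded (range Φ) := 
    hb.isCompact_closure.totallyBounded.subset subset_closure
  obtain ⟨P, hPr, hPf, hP⟩ := Metric.finite_approx_of_totallyBounded htb δ hδ
  choose! r hr using fun y (hy : y ∈ P) => hPr hy
  refine ⟨hPf.toFinset.image r, fun t => ?_⟩
  obtain ⟨y, hy, hty⟩ := mem_iUnion₂.1 (hP ⟨t, rfl⟩)
  refine ⟨r y, Finset.mem_image_of_mem _ (hPf.mem_toFinset.2 hy), fun lam hlam => ?_⟩
  rw [norm_chi_sub_one, ← dist_eq_norm]
  rw [← hr y hy] at hty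
  exact (dist_le_pi_dist (Φ t) (Φ (r y)) ⟨lam, hlam⟩).trans_lt hty

/-- A trigonometric polynomial changes little under translation by an element of a Bohr
neighbourhood of `0`, and Bohr neighbourhoods are relatively dense. -/
lemma isAlmostPeriodic_of_mem_trigPoly {q : BoundedContinuousFunction ℝ ℂ} (hq : q ∈ trigPoly) :
    IsAlmostPeriodic q := by
  refine ⟨q.continuous, fun ε hε => ?_⟩
  have key : ∃ Λ : Finset ℝ, ∀ ε > 0, ∃ δ > 0, ∀ τ, (∀ lam ∈ Λ, ‖chi lam τ - 1‖ < δ) →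
      ∀ t, ‖q t - q (t + τ)‖ < ε := by
    classical
    have hq' : q ∈ Submodule.span ℂ (range chi) := by rw [← trigPoly_eq_span]; exact hq
    induction hq' using Submodule.span_induction with
    | mem u hu =>
      obtain ⟨lam, rfl⟩ := hu
      refine ⟨{lam}, fun ε hε => ⟨ε, hε, fun τ hτ t => ?_⟩⟩
      rw [← norm_neg, neg_sub, ← norm_chi_sub_one, add_sub_cancel_left]
      exact hτ lam (Finset.mem_singleton_self _)
    | zero => exact ⟨∅, fun ε hε => ⟨1, one_pos, fun τ _ t => by simpa using hε⟩⟩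
    | add u v hu hv ihu ihv =>
      obtain ⟨Λ₁, h₁⟩ := ihu (trigPoly_eq_span.ge hu)
      obtain ⟨Λ₂, h₂⟩ := ihv (trigPoly_eq_span.ge hv)
      refine ⟨Λ₁ ∪ Λ₂, fun ε hε => ?_⟩
      obtain ⟨δ₁, hδ₁, h₁⟩ := h₁ (ε / 2) (half_pos hε)
      obtain ⟨δ₂, hδ₂, h₂⟩ := h₂ (ε / 2) (half_pos hε)
      refine ⟨min δ₁ δ₂, lt_min hδ₁ hδ₂, fun τ hτ t => ?_⟩
      have e₁ := h₁ τ (fun lam hl => (hτ lam (Finset.mem_union_left _ hl)).trans_le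
        (min_le_left _ _)) t
      have e₂ := h₂ τ (fun lam hl => (hτ lam (Finset.mem_union_right _ hl)).trans_le
        (min_le_right _ _)) t
      calc ‖(u + v) t - (u + v) (t + τ)‖ = ‖(u t - u (t + τ)) + (v t - v (t + τ))‖ := by
            simp only [BoundedContinuousFunction.coe_add, Pi.add_apply]; ring_nf
        _ ≤ ‖u t - u (t + τ)‖ + ‖v t - v (t + τ)‖ := norm_add_le _ _
        _ < ε := by linarith
    | smul c u hu ihu =>
      obtain ⟨Λ, h⟩ := ihu (trigPoly_eq_span.ge hu)
      refine ⟨Λ, fun ε hε => ?_⟩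
      obtain ⟨δ, hδ, h⟩ := h (ε / (‖c‖ + 1)) (by positivity)
      refine ⟨δ, hδ, fun τ hτ t => ?_⟩
      have e := h τ hτ t
      rw [lt_div_iff₀ (by positivity)] at e
      simp only [BoundedContinuousFunction.coe_smul, smul_eq_mul]
      rw [← mul_sub, norm_mul]
      nlinarith [norm_nonneg (u t - u (t + τ))]
  obtain ⟨Λ, h⟩ := key
  obtain ⟨δ, hδ, h⟩ := h ε hε
  obtain ⟨T, hT⟩ := exists_finset_translates_bohr Λ hδ
  obtain ⟨R, hR⟩ := T.bddAbove.exists_ge (0 : ℝ) |>.imp fun _ h => h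
  obtain ⟨R', hR'⟩ := T.bddBelow.exists_le (0 : ℝ) |>.imp fun _ h => h
  refine ⟨R - R' + 1, by linarith [hR.1, hR'.1], fun t₀ => ?_⟩
  obtain ⟨a, haT, ha⟩ := hT (t₀ + R)
  have h1 := hR.2 a haT
  have h2 := hR'.2 a haT
  exact ⟨t₀ + R - a, ⟨by linarith, by linarith⟩, h _ ha⟩

/-! ### Almost periodic functions have Bohr sets of almost periods -/

lemma IsAlmostPeriodic.exists_bound {f : ℝ → ℂ} (hf : IsAlmostPeriodic f) :
    ∃ C, ∀ t, ‖f t‖ ≤ C := by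
  obtain ⟨l, hl, h⟩ := hf.2 1 one_pos
  obtain ⟨C, hC⟩ := isCompact_Icc.exists_bound_of_continuousOn (s := Icc 0 l) hf.1.continuousOn
  refine ⟨C + 1, fun t => ?_⟩
  obtain ⟨τ, hτ, h⟩ := h (-t)
  have h1 := hC (t + τ) ⟨by linarith [hτ.1], by linarith [hτ.2]⟩
  have h2 := norm_le_norm_add_norm_sub' (f t) (f (t + τ))
  have h3 := h t
  linarith

lemma IsAlmostPeriodic.uniformContinuous {f : ℝ → ℂ} (hf : IsAlmostPeriodic f) :
    UniformContinuous f := by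
  rw [Metric.uniformContinuous_iff]
  intro ε hε
  obtain ⟨l, hl, h⟩ := hf.2 (ε / 3) (by positivity)
  have huc := (isCompact_Icc (a := -1) (b := l + 1)).uniformContinuousOn_of_continuous
    hf.1.continuousOn
  rw [Metric.uniformContinuousOn_iff] at huc
  obtain ⟨δ, hδ, huc⟩ := huc (ε / 3) (by positivity)
  refine ⟨min δ 1, lt_min hδ one_pos, fun s t hst => ?_⟩
  obtain ⟨τ, hτ, h⟩ := h (-t)
  have hst1 := hst.trans_le (min_le_right _ _)
  rw [Real.dist_eq, abs_lt] at hst1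
  have h1 := huc (s + τ) ⟨by linarith [hτ.1], by linarith [hτ.2]⟩ (t + τ)
    ⟨by linarith [hτ.1], by linarith [hτ.2]⟩ (by
      rw [dist_add_right]; exact hst.trans_le (min_le_left _ _))
  have h2 := h s
  have h3 := h t
  rw [← dist_eq_norm] at h2 h3
  have h4 := dist_triangle4 (f s) (f (s + τ)) (f (t + τ)) (f t)
  rw [dist_comm (f (t + τ)) (f t)] at h4
  linarith

/-- The lower bound for a chord of the unit circle in terms of its angle. -/
lemma four_mul_abs_le_norm_chi_sub_one {x : ℝ} (hx : |x| ≤ 1 / 2) :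
    4 * |x| ≤ ‖chi (2 * Real.pi) x - 1‖ := by
  have h1 : chi (2 * Real.pi) x = Complex.exp (Complex.I * ((2 * Real.pi * x : ℝ) : ℂ)) := by
    rw [chi_apply]; push_cast; ring_nf
  rw [h1, Complex.norm_exp_I_mul_ofReal_sub_one, norm_mul, Real.norm_two, Real.norm_eq_abs,
    show 2 * Real.pi * x / 2 = Real.pi * x by ring]
  have hpi := Real.pi_pos
  have h2 : |Real.sin (Real.pi * x)| = Real.sin (Real.pi * |x|) := by
    rcases le_total 0 x with h | h
    · rw [abs_of_nonneg h] at hx ⊢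
      exact abs_of_nonneg (Real.sin_nonneg_of_nonneg_of_le_pi (by positivity) (by nlinarith))
    · rw [abs_of_nonpos h] at hx ⊢
      rw [mul_neg, Real.sin_neg]
      refine abs_of_nonpos ?_
      exact Real.sin_nonpos_of_nonpos_of_neg_pi_le (by nlinarith) (by nlinarith)
  have h3 := Real.mul_le_sin (x := Real.pi * |x|) (by positivity) (by nlinarith)
  rw [h2]
  have h4 : 2 / Real.pi * (Real.pi * |x|) = 2 * |x| := by field_simp
  linarith

/-- The `ε`-almost periods of an almost periodic function contain a Bohr neighbourhood of `0`. -/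
lemma IsAlmostPeriodic.exists_bohr {f : ℝ → ℂ} (hf : IsAlmostPeriodic f) {ε : ℝ} (hε : 0 < ε) :
    ∃ Λ : Finset ℝ, ∃ η > 0, ∀ τ, (∀ lam ∈ Λ, ‖chi lam τ - 1‖ < η) →
      ∀ t, ‖f (t + τ) - f t‖ ≤ ε := by
  classical
  obtain ⟨l, hl, hper⟩ := hf.2 (ε / 9) (by positivity)
  obtain ⟨h, hh, huc⟩ := Metric.uniformContinuous_iff.1 hf.uniformContinuous (ε / 9) (by positivity)
  -- Bogolyubov's lemma is applied to the almost periods in the lattice of step `h`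
  set h' := h / 2 with hh'
  have hh0 : 0 < h' := half_pos hh
  have huc' : ∀ s t : ℝ, |s - t| ≤ h' → ‖f s - f t‖ ≤ ε / 9 := fun s t hst => by
    rw [← dist_eq_norm]
    exact (huc (by rw [Real.dist_eq]; linarith)).le
  clear_value h'
  have hh0c : (h' : ℂ) ≠ 0 := by exact_mod_cast hh0.ne'
  set A : Set ℤ := {n | ∀ t, ‖f (t + n * h') - f t‖ ≤ 2 * (ε / 9)} with hA
  obtain ⟨K, θ, hθ⟩ := bogolyubov_int A (⌈l / h'⌉₊ + 1) fun m => by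
    obtain ⟨τ, hτ, h1⟩ := hper (m * h')
    refine ⟨⌊τ / h'⌋, fun t => ?_, ?_, ?_⟩
    · have h2 := Int.floor_le (τ / h')
      have h3 := Int.lt_floor_add_one (τ / h')
      rw [le_div_iff₀ hh0] at h2
      rw [div_lt_iff₀ hh0] at h3
      have h4 := huc' (t + ⌊τ / h'⌋ * h') (t + τ) (by rw [abs_le]; constructor <;> linarith)
      have h5 := h1 t
      have h6 := norm_sub_le_norm_sub_add_norm_sub (f (t + ⌊τ / h'⌋ * h')) (f (t + τ)) (f t)
      rw [norm_sub_rev] at h5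
      linarith
    · rw [Int.le_floor, le_div_iff₀ hh0]; exact hτ.1
    · rw [Int.floor_lt, div_lt_iff₀ hh0]
      push_cast
      have h7 := Nat.le_ceil (l / h')
      rw [div_le_iff₀ hh0] at h7
      nlinarith [hτ.2]
  refine ⟨insert (2 * Real.pi / h') (Finset.univ.image fun j => Complex.arg (θ j) / h'), 1 / 8,
    by norm_num, fun τ hτ t => ?_⟩
  -- The frequency `2π / h'` forces `τ` to be close to the lattice point `n * h'`, and the frequencies
  -- `arg (θ j) / h'` then force `θ j ^ n` to be close to `1`.
  set n := round (τ / h') with hn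
  set x := τ / h' - n with hx
  have hx2 : |x| ≤ 1 / 2 := abs_sub_round _
  have hτx : τ = (x + n) * h' := by rw [hx]; field_simp; ring
  have hx8 : |x| ≤ 1 / 32 := by
    have h1 := hτ _ (Finset.mem_insert_self _ _)
    have h2 : chi (2 * Real.pi / h') τ = chi (2 * Real.pi) x := by
      rw [hτx, chi_apply, chi_apply]
      rw [Complex.exp_eq_exp_iff_exists_int]
      refine ⟨n, ?_⟩
      push_cast
      field_simp
    rw [h2] at h1
    have h3 := four_mul_abs_le_norm_chi_sub_one hx2
    linarith
  obtain ⟨a, ha, b, hb, c, hc, d, hd, hsum⟩ := hθ n fun j => by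
    set α := Complex.arg (θ j) with hα
    have h1 := hτ (α / h')
      (Finset.mem_insert_of_mem (Finset.mem_image_of_mem _ (Finset.mem_univ j)))
    have h2 : ((θ j ^ n : Circle) : ℂ) = chi α n := by
      conv_lhs => rw [← Circle.exp_arg (θ j)]
      rw [← Circle.exp_zsmul, Circle.coe_exp, chi_apply]
      congr 1
      rw [zsmul_eq_mul]; push_cast; ring
    have h3 : chi (α / h') τ = chi α n * chi α x := by
      rw [← chi_add_right, chi_apply, chi_apply, hτx]
      congr 1
      push_cast
      field_simp
      ring
    have h4 : ‖chi α x - 1‖ ≤ |α * x| := by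
      have : chi α x = Complex.exp (Complex.I * ((α * x : ℝ) : ℂ)) := by
        rw [chi_apply]; push_cast; ring_nf
      rw [this]
      exact Real.norm_exp_I_mul_ofReal_sub_one_le
    have h5 : |α * x| ≤ 4 * (1 / 32) := by
      rw [abs_mul]
      refine mul_le_mul ?_ hx8 (abs_nonneg _) (by norm_num)
      exact (Complex.abs_arg_le_pi _).trans Real.pi_le_four
    have h6 : ‖chi α n - 1‖ ≤ ‖chi (α / h') τ - 1‖ + ‖chi α x - 1‖ := by
      have e : chi α n - 1 = (chi (α / h') τ - 1) - chi α n * (chi α x - 1) := by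
        rw [h3]; ring
      rw [e]
      refine (norm_sub_le _ _).trans_eq ?_
      rw [norm_mul, norm_chi, one_mul]
    rw [h2]
    linarith
  have e1 := hc (t - c * h')
  have e2 := hd (t - c * h' - d * h')
  have e3 := ha (t - c * h' - d * h')
  have e4 := hb (t - c * h' - d * h' + a * h')
  have e5 := huc' (t + τ) (t + n * h') (by
    rw [hτx, show t + (x + n) * h' - (t + n * h') = x * h' by ring, abs_mul, abs_of_pos hh0]
    nlinarith)
  have hn' : (n : ℝ) = a + b - c - d := by exact_mod_cast hsum
  rw [show t + n * h' = t - c * h' - d * h' + a * h' + b * h' by rw [hn']; ring] at e5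
  rw [sub_add_cancel] at e1 e2
  rw [← dist_eq_norm] at *
  linarith [dist_triangle_right (f t) (f (t - c * h' - d * h')) (f (t - c * h')),
    dist_triangle4 (f (t + τ)) (f (t - c * h' - d * h' + a * h' + b * h'))
      (f (t - c * h' - d * h' + a * h')) (f (t - c * h' - d * h')),
    dist_triangle_right (f (t + τ)) (f t) (f (t - c * h' - d * h')),
    dist_triangle (f t) (f (t - c * h')) (f (t - c * h' - d * h'))]

/-! ### An invariant mean and the approximation theorem -/

/-- The average of a bounded continuous function over `[0, n]`. -/
noncomputable def avg (u : BoundedContinuousFunction ℝ ℂ) (n : ℕ) : ℂ :=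
  (n : ℂ)⁻¹ * ∫ t in (0 : ℝ)..n, u t

/-- A translation-invariant mean on the bounded continuous functions: the limit of the averages
over `[0, n]` along a fixed nonprincipal ultrafilter, which exists for every such function. -/
noncomputable def mean (u : BoundedContinuousFunction ℝ ℂ) : ℂ :=
  limUnder (hyperfilter ℕ : Filter ℕ) (avg u)

lemma intervalIntegrable_bcf (u : BoundedContinuousFunction ℝ ℂ) (a b : ℝ) :
    IntervalIntegrable u volume a b :=
  u.continuous.intervalIntegrable a b

lemma norm_avg_le (u : BoundedContinuousFunction ℝ ℂ) (n : ℕ) : ‖avg u n‖ ≤ ‖u‖ := by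
  rcases n.eq_zero_or_pos with rfl | hn
  · simp [avg]
  have hn' : (0 : ℝ) < n := by exact_mod_cast hn
  rw [avg, norm_mul, norm_inv, Complex.norm_natCast, inv_mul_le_iff₀ hn', mul_comm]
  refine (intervalIntegral.norm_integral_le_of_norm_le_const
    fun t _ => u.norm_coe_le_norm t).trans_eq ?_
  rw [sub_zero, abs_of_pos hn']

lemma tendsto_avg (u : BoundedContinuousFunction ℝ ℂ) :
    Tendsto (avg u) (hyperfilter ℕ) (𝓝 (mean u)) := by
  refine tendsto_nhds_limUnder ?_
  obtain ⟨x, -, hx⟩ := (isCompact_closedBall (0 : ℂ) ‖u‖).ultrafilter_le_nhds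
    ((hyperfilter ℕ).map (avg u)) (by
      rw [le_principal_iff]
      show ∀ᶠ n in (hyperfilter ℕ : Filter ℕ), avg u n ∈ Metric.closedBall 0 ‖u‖
      exact Eventually.of_forall fun n => mem_closedBall_zero_iff.2 (norm_avg_le u n))
  exact ⟨x, hx⟩

lemma mean_add (u v : BoundedContinuousFunction ℝ ℂ) : mean (u + v) = mean u + mean v := by
  refine tendsto_nhds_unique (tendsto_avg _)
    (((tendsto_avg u).add (tendsto_avg v)).congr fun n => ?_)
  rw [avg, avg, avg, ← mul_add, ← intervalIntegral.integral_add (intervalIntegrable_bcf _ _ _)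
    (intervalIntegrable_bcf _ _ _)]
  rfl

lemma mean_smul (c : ℂ) (u : BoundedContinuousFunction ℝ ℂ) : mean (c • u) = c * mean u := by
  refine tendsto_nhds_unique (tendsto_avg _) (((tendsto_avg u).const_mul c).congr fun n => ?_)
  rw [avg, avg, mul_left_comm, ← intervalIntegral.integral_const_mul]
  rfl

lemma mean_sum {ι : Type*} (s : Finset ι) (u : ι → BoundedContinuousFunction ℝ ℂ) :
    mean (∑ i ∈ s, u i) = ∑ i ∈ s, mean (u i) := by
  classical
  induction s using Finset.induction_on with
  | empty => simpa using mean_smul 0 0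
  | insert i s hi ih => rw [Finset.sum_insert hi, Finset.sum_insert hi, mean_add, ih]

lemma mean_one : mean 1 = 1 := by
  refine tendsto_nhds_unique (tendsto_avg _) (tendsto_const_nhds.congr' ?_)
  have : ∀ᶠ n : ℕ in hyperfilter ℕ, n ≠ 0 :=
    hyperfilter_le_cofinite (Set.finite_singleton 0).compl_mem_cofinite
  filter_upwards [this] with n hn
  have hn' : (n : ℂ) ≠ 0 := by exact_mod_cast hn
  simp [avg, hn']

lemma mean_translate (x : ℝ) (u : BoundedContinuousFunction ℝ ℂ) :
    mean (translate x u) = mean u := by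
  refine tendsto_nhds_unique_of_eventuallyEq (l := (hyperfilter ℕ : Filter ℕ))
    (f := avg (translate x u)) (g := fun n => avg u n + (avg (translate x u) n - avg u n))
    (tendsto_avg _) ?_ (Eventually.of_forall fun n => by ring)
  rw [← add_zero (mean u)]
  refine (tendsto_avg u).add ?_
  have hle : (hyperfilter ℕ : Filter ℕ) ≤ atTop := by
    rw [← Nat.cofinite_eq_atTop]; exact hyperfilter_le_cofinite
  refine Tendsto.mono_left ?_ hle
  -- the two averages differ by integrals over two intervals of length `|x|`
  refine squeeze_zero_norm (a := fun n : ℕ => (2 * ‖u‖ * |x|) * (n : ℝ)⁻¹) (fun n => ?_) ?_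
  · have h1 : ∫ t in (0 : ℝ)..n, translate x u t = ∫ t in x..(x + n), u t := by
      simp only [translate_apply]
      rw [intervalIntegral.integral_comp_add_left (fun t => u t)]
      simp
    rw [avg, avg, ← mul_sub, norm_mul, norm_inv, Complex.norm_natCast, mul_comm, h1,
      intervalIntegral.integral_interval_sub_interval_comm (intervalIntegrable_bcf _ _ _)
        (intervalIntegrable_bcf _ _ _) (intervalIntegrable_bcf _ _ _)]
    refine mul_le_mul_of_nonneg_right ?_ (by positivity)
    have h2 : ∀ a b, ‖∫ t in a..b, u t‖ ≤ ‖u‖ * |b - a| := fun a b =>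
      intervalIntegral.norm_integral_le_of_norm_le_const fun t _ => u.norm_coe_le_norm t
    have h3 := h2 x 0
    have h4 := h2 (x + n) n
    rw [show (0 : ℝ) - x = -x by ring, abs_neg] at h3
    rw [show (n : ℝ) - (x + n) = -x by ring, abs_neg] at h4
    refine (norm_sub_le _ _).trans ?_
    linarith
  · simpa using (tendsto_inv_atTop_nhds_zero_nat (𝕜 := ℝ)).const_mul (2 * ‖u‖ * |x|)

lemma norm_mean_le {u v : BoundedContinuousFunction ℝ ℂ} (h : ∀ t, ‖u t‖ ≤ (v t).re) :
    ‖mean u‖ ≤ (mean v).re := by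
  refine le_of_tendsto_of_tendsto (tendsto_avg u).norm
    ((Complex.continuous_re.tendsto _).comp (tendsto_avg v)) (Eventually.of_forall fun n => ?_)
  have h1 : (avg v n).re = (n : ℝ)⁻¹ * ∫ t in (0 : ℝ)..n, (v t).re := by
    have h2 : ∫ t in (0 : ℝ)..n, (v t).re = (∫ t in (0 : ℝ)..n, v t).re :=
      Complex.reCLM.intervalIntegral_comp_comm (intervalIntegrable_bcf _ _ _)
    rw [h2, avg, ← Complex.ofReal_natCast, ← Complex.ofReal_inv, Complex.re_ofReal_mul]
  simp only [Function.comp_apply]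
  rw [h1, avg, norm_mul, norm_inv, Complex.norm_natCast]
  refine mul_le_mul_of_nonneg_left ?_ (by positivity)
  exact intervalIntegral.norm_integral_le_of_norm_le (by positivity)
    (Eventually.of_forall fun t _ => h t)
    ((Complex.continuous_re.comp v.continuous).intervalIntegrable _ _)

/-- The convolution of a bounded continuous function with a trigonometric polynomial is a
trigonometric polynomial. -/
lemma exists_trigPoly_eq_mean (f : BoundedContinuousFunction ℝ ℂ)
    {k : BoundedContinuousFunction ℝ ℂ} (hk : k ∈ trigPoly) :
    ∃ q ∈ trigPoly, ∀ x, q x = mean (translate x f * k) := by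
  have hk' : k ∈ Submodule.span ℂ (range chi) := by rw [← trigPoly_eq_span]; exact hk
  clear hk
  induction hk' using Submodule.span_induction with
  | mem u hu =>
    obtain ⟨lam, rfl⟩ := hu
    refine ⟨mean (f * chi lam) • chi (-lam), trigPoly.smul_mem (chi_mem_trigPoly _) _, fun x => ?_⟩
    have h : translate x f * chi lam = chi (-lam) x • translate x (f * chi lam) := by
      ext t
      simp only [BoundedContinuousFunction.coe_mul, BoundedContinuousFunction.coe_smul,
        Pi.mul_apply, translate_apply, smul_eq_mul]
      have : chi lam t = chi (-lam) x * chi lam (x + t) := by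
        rw [← chi_neg_right, ← chi_add_right]; ring_nf
      rw [this]; ring
    rw [h, mean_smul, mean_translate, BoundedContinuousFunction.smul_apply, smul_eq_mul, mul_comm]
  | zero => exact ⟨0, trigPoly.zero_mem, fun x => by simpa using (mean_smul 0 0).symm⟩
  | add u v _ _ hu hv =>
    obtain ⟨q, hq, hqx⟩ := hu
    obtain ⟨r, hr, hrx⟩ := hv
    exact ⟨q + r, trigPoly.add_mem hq hr, fun x => by
      rw [mul_add, mean_add, ← hqx, ← hrx]; rfl⟩
  | smul c u _ hu =>
    obtain ⟨q, hq, hqx⟩ := hu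
    exact ⟨c • q, trigPoly.smul_mem hq c, fun x => by
      rw [mul_smul_comm, mean_smul, ← hqx]; rfl⟩

/-- A trigonometric polynomial `p` with values in `[0, 1]` which is at most `1 - c` off a given Bohr
neighbourhood of `0`, while finitely many translates of the set where it is at least `1 - c / 2`
cover the line. The powers of `p` therefore have their mass on the Bohr neighbourhood. -/
lemma exists_bohr_kernel (Λ : Finset ℝ) {η : ℝ} (hη : 0 < η) :
    ∃ (c : ℝ) (p : BoundedContinuousFunction ℝ ℂ) (P : ℝ → ℝ) (T : Finset ℝ), 0 < c ∧ c ≤ 1 ∧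
      p ∈ trigPoly ∧ (∀ t, p t = P t) ∧ (∀ t, 0 ≤ P t) ∧
      (∀ t, (¬ ∀ lam ∈ Λ, ‖chi lam t - 1‖ < η) → P t ≤ 1 - c) ∧
      ∀ t, ∃ a ∈ T, 1 - c / 2 ≤ P (t - a) := by
  set N : ℝ := Λ.card + 1 with hN
  have hN0 : 0 < N := by positivity
  set c : ℝ := min 1 (η ^ 2 / (4 * N)) with hc
  have hc0 : 0 < c := lt_min one_pos (by positivity)
  obtain ⟨T, hT⟩ := exists_finset_translates_bohr Λ (δ := Real.sqrt (2 * c)) (by positivity)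
  -- since `(χ - 1) * (conj χ - 1) = ‖χ - 1‖ ^ 2 ≤ 4` for every character `χ`
  refine ⟨c, 1 - ((1 / (4 * N) : ℝ) : ℂ) • ∑ lam ∈ Λ, (chi lam - 1) * (chi (-lam) - 1),
    fun t => 1 - 1 / (4 * N) * ∑ lam ∈ Λ, ‖chi lam t - 1‖ ^ 2, T, hc0, min_le_left _ _,
    ?_, fun t => ?_, fun t => ?_, fun t ht => ?_, fun t => ?_⟩
  · refine trigPoly.sub_mem trigPoly.one_mem (trigPoly.smul_mem (trigPoly.sum_mem fun lam _ => ?_) _)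
    exact trigPoly.mul_mem (trigPoly.sub_mem (chi_mem_trigPoly _) trigPoly.one_mem)
      (trigPoly.sub_mem (chi_mem_trigPoly _) trigPoly.one_mem)
  · have h : ∀ lam, (chi lam t - 1) * (chi (-lam) t - 1) = ((‖chi lam t - 1‖ ^ 2 : ℝ) : ℂ) := by
      intro lam
      rw [chi_neg_left, ← Complex.normSq_eq_norm_sq, ← Complex.mul_conj, map_sub, map_one]
    simp only [BoundedContinuousFunction.coe_sub, BoundedContinuousFunction.coe_smul,
      BoundedContinuousFunction.coe_sum, BoundedContinuousFunction.coe_mul, Pi.sub_apply,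
      Finset.sum_apply, Pi.mul_apply, BoundedContinuousFunction.coe_one, Pi.one_apply, h,
      smul_eq_mul]
    push_cast
    rfl
  · have h : ∑ lam ∈ Λ, ‖chi lam t - 1‖ ^ 2 ≤ Λ.card • (4 : ℝ) := by
      refine Finset.sum_le_card_nsmul _ _ _ fun lam _ => ?_
      have h1 : ‖chi lam t - 1‖ ≤ 2 := by
        refine (norm_sub_le _ _).trans_eq ?_
        rw [norm_chi, norm_one]; norm_num
      nlinarith [norm_nonneg (chi lam t - 1)]
    rw [nsmul_eq_mul] at h
    rw [sub_nonneg, one_div, inv_mul_le_iff₀ (by positivity)]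
    linarith
  · push Not at ht
    obtain ⟨lam, hlam, h⟩ := ht
    have h1 := Finset.single_le_sum (f := fun lam => ‖chi lam t - 1‖ ^ 2)
      (fun _ _ => by positivity) hlam
    have h2 : η ^ 2 ≤ ‖chi lam t - 1‖ ^ 2 := by gcongr
    have h3 : c ≤ η ^ 2 / (4 * N) := min_le_right _ _
    have h4 : η ^ 2 / (4 * N) ≤ 1 / (4 * N) * ∑ lam ∈ Λ, ‖chi lam t - 1‖ ^ 2 := by
      rw [div_eq_mul_one_div, mul_comm]
      exact mul_le_mul_of_nonneg_left (h2.trans h1) (by positivity)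
    linarith
  · obtain ⟨a, ha, h⟩ := hT t
    refine ⟨a, ha, ?_⟩
    have h1 : ∑ lam ∈ Λ, ‖chi lam (t - a) - 1‖ ^ 2 ≤ Λ.card • (2 * c) := by
      refine Finset.sum_le_card_nsmul _ _ _ fun lam hlam => ?_
      rw [← Real.sq_sqrt (by positivity : 0 ≤ 2 * c)]
      have := (h lam hlam).le
      gcongr
    rw [nsmul_eq_mul] at h1
    have h2 : 1 / (4 * N) * ∑ lam ∈ Λ, ‖chi lam (t - a) - 1‖ ^ 2 ≤ c / 2 := by
      rw [one_div, inv_mul_le_iff₀ (by positivity)]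
      nlinarith
    linarith

/-- **Bohr's approximation theorem**: an almost periodic function is a uniform limit of
trigonometric polynomials. -/
theorem IsAlmostPeriodic.exists_trigPoly {f : ℝ → ℂ} (hf : IsAlmostPeriodic f) {ε : ℝ}
    (hε : 0 < ε) : ∃ q ∈ trigPoly, ∀ t, ‖f t - q t‖ ≤ ε := by
  obtain ⟨C, hC⟩ := hf.exists_bound
  have hC0 : 0 ≤ C := (norm_nonneg _).trans (hC 0)
  set F := BoundedContinuousFunction.ofNormedAddCommGroup f hf.1 C hC with hF
  obtain ⟨Λ, η, hη, hΛ⟩ := hf.exists_bohr (half_pos hε)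
  obtain ⟨c, p, P, T, hc0, hc1, hp, hpP, hP0, hPout, hPin⟩ := exists_bohr_kernel Λ hη
  have hpow : ∀ m t, (p ^ m) t = ((P t ^ m : ℝ) : ℂ) := fun m t => by
    rw [BoundedContinuousFunction.coe_pow, Pi.pow_apply, hpP, Complex.ofReal_pow]
  -- the powers of the kernel concentrate on the Bohr set
  obtain ⟨m, hm⟩ : ∃ m : ℕ, T.card * (2 * C) * (1 - c) ^ m ≤ ε / 2 * (1 - c / 2) ^ m := by
    have hb : 0 < 1 - c / 2 := by linarith
    have h1 : Tendsto (fun m : ℕ => T.card * (2 * C) * ((1 - c) / (1 - c / 2)) ^ m) atTop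
        (𝓝 (T.card * (2 * C) * 0)) :=
      (tendsto_pow_atTop_nhds_zero_of_lt_one (div_nonneg (by linarith) hb.le)
        ((div_lt_one hb).2 (by linarith))).const_mul _
    rw [mul_zero] at h1
    obtain ⟨m, hm⟩ := (h1.eventually_le_const (half_pos hε)).exists
    refine ⟨m, ?_⟩
    rwa [div_pow, mul_div_assoc', div_le_iff₀ (by positivity)] at hm
  set k := p ^ m with hk
  -- averaging over the translates gives a lower bound for the mass of the kernel
  have hmass : (1 - c / 2) ^ m ≤ T.card * (mean k).re := by
    have h1 : ‖mean (((((1 - c / 2) ^ m : ℝ)) : ℂ) • 1)‖ ≤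
        (mean (∑ a ∈ T, translate (-a) k)).re := by
      refine norm_mean_le fun t => ?_
      obtain ⟨a, ha, hat⟩ := hPin t
      rw [BoundedContinuousFunction.coe_sum, Finset.sum_apply, Complex.re_sum]
      simp only [translate_apply, hk, hpow, Complex.ofReal_re]
      have h2 := Finset.single_le_sum (f := fun a => P (-a + t) ^ m)
        (fun a _ => pow_nonneg (hP0 _) m) ha
      refine le_trans ?_ h2
      rw [BoundedContinuousFunction.smul_apply, BoundedContinuousFunction.coe_one, Pi.one_apply,
        smul_eq_mul, mul_one, Complex.norm_real, Real.norm_eq_abs,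
        abs_of_nonneg (pow_nonneg (by linarith) m), neg_add_eq_sub]
      exact pow_le_pow_left₀ (by linarith) hat m
    rw [mean_smul, mean_one, mul_one, Complex.norm_real, Real.norm_eq_abs,
      abs_of_nonneg (pow_nonneg (by linarith) m), mean_sum] at h1
    simpa [mean_translate] using h1
  have hpos : 0 < (mean k).re := by
    have h1 : 0 < (1 - c / 2) ^ m := pow_pos (by linarith) m
    by_contra! h2
    have : (T.card : ℝ) * (mean k).re ≤ 0 := mul_nonpos_of_nonneg_of_nonpos (by positivity) h2
    linarith
  have hbound : ∀ x, ‖mean (translate x F * k) - f x * mean k‖ ≤ ε * (mean k).re := by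
    intro x
    have h1 : mean (translate x F * k) - f x * mean k =
        mean ((translate x F - f x • 1) * k) := by
      rw [show (translate x F - f x • 1) * k = translate x F * k + (-f x) • k by
        rw [sub_mul, smul_one_mul, neg_smul, sub_eq_add_neg], mean_add, mean_smul]
      ring
    have h2 : ‖mean ((translate x F - f x • 1) * k)‖ ≤
        (mean (((ε / 2 : ℝ) : ℂ) • k + (((2 * C * (1 - c) ^ m : ℝ)) : ℂ) • 1)).re := by
      refine norm_mean_le fun t => ?_
      have hk0 : 0 ≤ P t ^ m := pow_nonneg (hP0 t) m
      have e1 : ‖((translate x F - f x • 1) * k) t‖ = ‖f (x + t) - f x‖ * P t ^ m := by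
        rw [BoundedContinuousFunction.coe_mul, Pi.mul_apply, norm_mul, hk, hpow,
          Complex.norm_real, Real.norm_eq_abs, abs_of_nonneg hk0]
        congr 2
        simp [translate_apply, hF]
      have e2 : ((((ε / 2 : ℝ) : ℂ) • k + (((2 * C * (1 - c) ^ m : ℝ)) : ℂ) • 1) t).re =
          ε / 2 * P t ^ m + 2 * C * (1 - c) ^ m := by
        simp only [BoundedContinuousFunction.coe_add, Pi.add_apply,
          BoundedContinuousFunction.coe_smul, BoundedContinuousFunction.coe_one, Pi.one_apply,
          smul_eq_mul, mul_one, hk, hpow, ← Complex.ofReal_mul, ← Complex.ofReal_add,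
          Complex.ofReal_re]
      rw [e1, e2]
      have h0 : 0 ≤ (1 - c) ^ m := pow_nonneg (by linarith) m
      by_cases ht : ∀ lam ∈ Λ, ‖chi lam t - 1‖ < η
      · have := mul_le_mul_of_nonneg_right (hΛ t ht x) hk0
        have : 0 ≤ 2 * C * (1 - c) ^ m := by positivity
        linarith
      · have h3 : P t ^ m ≤ (1 - c) ^ m := pow_le_pow_left₀ (hP0 t) (hPout t ht) m
        have h4 : ‖f (x + t) - f x‖ ≤ 2 * C :=
          (norm_sub_le _ _).trans (by linarith [hC (x + t), hC x])
        have h5 := mul_le_mul h4 h3 hk0 (by positivity)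
        have : 0 ≤ ε / 2 * P t ^ m := by positivity
        linarith
    rw [h1]
    refine h2.trans ?_
    rw [mean_add, mean_smul, mean_smul, mean_one, mul_one, Complex.add_re, Complex.re_ofReal_mul,
      Complex.ofReal_re]
    have hT0 : (0 : ℝ) < T.card := by
      by_contra! h3
      have h4 : (T.card : ℝ) * (mean k).re ≤ 0 := mul_nonpos_of_nonpos_of_nonneg h3 hpos.le
      have : 0 < (1 - c / 2) ^ m := pow_pos (by linarith) m
      linarith
    have h5 : T.card * (2 * C * (1 - c) ^ m) ≤ T.card * (ε / 2 * (mean k).re) := by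
      nlinarith
    have := le_of_mul_le_mul_left h5 hT0
    linarith
  obtain ⟨q, hq, hqx⟩ := exists_trigPoly_eq_mean F (trigPoly.pow_mem hp m)
  refine ⟨(mean k)⁻¹ • q, trigPoly.smul_mem hq _, fun t => ?_⟩
  have hne : mean k ≠ 0 := fun h => by simp [h] at hpos
  have h1 : f t - ((mean k)⁻¹ • q) t =
      -((mean k)⁻¹ * (mean (translate t F * k) - f t * mean k)) := by
    rw [BoundedContinuousFunction.smul_apply, smul_eq_mul, hqx]
    field_simp
    ring
  rw [h1, norm_neg, norm_mul, norm_inv, inv_mul_le_iff₀ (norm_pos_iff.2 hne)]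
  refine (hbound t).trans ?_
  rw [mul_comm]
  exact mul_le_mul_of_nonneg_right (Complex.re_le_norm _) hε.le

/-! ### Coordinates on the circle -/

lemma unit_mul_self (k : ℤˣ) : ((k : ℤ) : ℝ) * ((k : ℤ) : ℝ) = 1 := by
  rcases Int.units_eq_one_or k with rfl | rfl <;> norm_num

lemma unit_ne_zero (k : ℤˣ) : ((k : ℤ) : ℝ) ≠ 0 := fun h => by
  have := unit_mul_self k
  simp [h] at this

lemma pt_zero (t₀ : ℝ) (k : ℤˣ) : pt t₀ k 0 = Circle.exp t₀ := by simp [pt]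

lemma pt_one (t₀ t : ℝ) : pt t₀ 1 t = Circle.exp (t₀ + t) := by simp [pt]

lemma continuous_pt (t₀ : ℝ) (k : ℤˣ) : Continuous (pt t₀ k) :=
  Circle.exp.continuous.comp (by fun_prop)

lemma isOpenMap_pt (t₀ : ℝ) (k : ℤˣ) : IsOpenMap (pt t₀ k) :=
  isLocalHomeomorph_circleExp.isOpenMap.comp <|
    (Homeomorph.addLeft t₀).isOpenMap.comp (Homeomorph.mulLeft₀ _ (unit_ne_zero k)).isOpenMap

lemma isOpen_arc (t₀ : ℝ) (k : ℤˣ) (s : ℝ) : IsOpen (arc t₀ k s) := isOpenMap_pt t₀ k _ isOpen_Ioo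

/-- The other end of the coordinate at `e^{it₀}`. -/
lemma pt_neg (t₀ : ℝ) (k : ℤˣ) (t : ℝ) : pt t₀ (-k) t = pt t₀ k (2 * Real.pi - t) := by
  refine Circle.exp_eq_exp.2 ⟨-(k : ℤ), ?_⟩
  push_cast
  ring

lemma pt_congr {t₀ t₁ : ℝ} (h : Circle.exp t₀ = Circle.exp t₁) (k : ℤˣ) : pt t₀ k = pt t₁ k := by
  funext t
  rw [pt, pt, Circle.exp_add, Circle.exp_add, h]

lemma exists_pt_eq (t₀ : ℝ) (k : ℤˣ) {z : Circle} (hz : z ≠ Circle.exp t₀) :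
    ∃ t ∈ Ioo 0 (2 * Real.pi), pt t₀ k t = z := by
  set x := ((k : ℤ) : ℝ) * (Complex.arg (z : ℂ) - t₀) with hx
  have hmem := toIcoMod_mem_Ico' Real.two_pi_pos x
  have hpt : pt t₀ k (toIcoMod Real.two_pi_pos 0 x) = z := by
    conv_rhs => rw [← Circle.exp_arg z]
    refine Circle.exp_eq_exp.2 ⟨-((k : ℤ) * toIcoDiv Real.two_pi_pos 0 x), ?_⟩
    rw [toIcoMod, zsmul_eq_mul, hx]
    push_cast
    linear_combination (Complex.arg (z : ℂ) - t₀) * unit_mul_self k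
  refine ⟨_, ⟨lt_of_le_of_ne hmem.1 fun h => hz ?_, hmem.2⟩, hpt⟩
  rw [← hpt, ← h, pt_zero]

lemma pt_ne (t₀ : ℝ) (k : ℤˣ) {t : ℝ} (ht : t ∈ Ioo 0 (2 * Real.pi)) :
    pt t₀ k t ≠ Circle.exp t₀ := by
  intro h
  obtain ⟨m, hm⟩ := Circle.exp_eq_exp.1 h
  have h1 : t = (((k : ℤ) * m : ℤ) : ℝ) * (2 * Real.pi) := by
    push_cast
    linear_combination ((k : ℤ) : ℝ) * hm - t * unit_mul_self k
  have hpi := Real.two_pi_pos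
  have h2 : (0 : ℝ) < (((k : ℤ) * m : ℤ) : ℝ) := by
    by_contra! h3
    nlinarith [ht.1]
  have h3 : (((k : ℤ) * m : ℤ) : ℝ) < 1 := by
    by_contra! h3
    nlinarith [ht.2]
  norm_cast at h2 h3
  omega

lemma arc_subset_compl (t₀ : ℝ) (k : ℤˣ) {s : ℝ} (hs : s ≤ 2 * Real.pi) :
    arc t₀ k s ⊆ {Circle.exp t₀}ᶜ := by
  rintro _ ⟨t, ht, rfl⟩
  exact pt_ne t₀ k ⟨ht.1, ht.2.trans_le hs⟩

lemma continuousOn_compl_of_comp_pt {X : Type*} [TopologicalSpace X] {u : Circle → X} (t₀ : ℝ)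
    (k : ℤˣ) (h : ContinuousOn (fun t => u (pt t₀ k t)) (Ioo 0 (2 * Real.pi))) :
    ContinuousOn u {Circle.exp t₀}ᶜ := by
  intro z hz
  obtain ⟨t, ht, rfl⟩ := exists_pt_eq t₀ k hz
  refine ContinuousAt.continuousWithinAt ?_
  have h1 : Tendsto (fun t => u (pt t₀ k t)) (𝓝 t) (𝓝 (u (pt t₀ k t))) :=
    h.continuousAt (isOpen_Ioo.mem_nhds ht)
  have h2 : map (pt t₀ k) (𝓝 t) = 𝓝 (pt t₀ k t) :=
    (isOpenMap_pt t₀ k).map_nhds_eq (continuous_pt t₀ k).continuousAt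
  rw [ContinuousAt, ← h2]
  exact tendsto_map'_iff.2 h1

lemma continuousOn_logAt (t₀ : ℝ) (k : ℤˣ) : ContinuousOn (logAt t₀ k) {Circle.exp t₀}ᶜ := by
  refine continuousOn_compl_of_comp_pt t₀ k (ContinuousOn.congr (f := Real.log) ?_ fun t ht =>
    logAt_pt t₀ k ht)
  exact Real.continuousOn_log.mono fun t ht => ht.1.ne'

lemma expLogAt_eq (lam t₀ : ℝ) (k : ℤˣ) (z : Circle) :
    expLogAt lam t₀ k z = chi lam (logAt t₀ k z) := rfl

lemma continuousOn_expLogAt (lam t₀ : ℝ) (k : ℤˣ) :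
    ContinuousOn (expLogAt lam t₀ k) {Circle.exp t₀}ᶜ :=
  (chi lam).continuous.comp_continuousOn (continuousOn_logAt t₀ k)

lemma jumpAt_pt_one (g : Circle → ℝ) (t₀ t : ℝ) : jumpAt g t₀ (pt t₀ 1 t) = g (Circle.exp t) := by
  rw [jumpAt, pt_one, Circle.exp_add, mul_div_cancel_left]

lemma continuousOn_jumpAt {g : Circle → ℝ} (hg : IsJumpFunction g) (t₀ : ℝ) :
    ContinuousOn (jumpAt g t₀) {Circle.exp t₀}ᶜ := by
  refine hg.continuousOn.comp (continuous_id.div_const _).continuousOn fun z hz => ?_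
  simpa [div_eq_one] using hz

/-! ### Arc length -/

instance isFiniteMeasure_arcLength : IsFiniteMeasure arcLength := by
  unfold arcLength
  infer_instance

lemma arcLength_apply {U : Set Circle} (hU : MeasurableSet U) :
    arcLength U = volume (Circle.exp ⁻¹' U ∩ Ioc 0 (2 * Real.pi)) := by
  rw [arcLength, Measure.map_apply Circle.exp.continuous.measurable hU,
    Measure.restrict_apply (Circle.exp.continuous.measurable hU)]

instance nullSingletonClass_arcLength : NullSingletonClass arcLength := by
  refine ⟨fun z => ?_⟩
  rw [arcLength_apply (measurableSet_singleton z)]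
  refine (Set.Countable.mono inter_subset_left ?_).measure_zero _
  rcases (Circle.exp ⁻¹' {z}).eq_empty_or_nonempty with h | ⟨x, hx⟩
  · rw [h]; exact countable_empty
  · refine (countable_range fun m : ℤ => x + m * (2 * Real.pi)).mono fun y hy => ?_
    obtain ⟨m, hm⟩ := Circle.exp_eq_exp.1 (hy.trans hx.symm : Circle.exp y = Circle.exp x)
    exact ⟨m, hm.symm⟩

instance isOpenPosMeasure_arcLength : arcLength.IsOpenPosMeasure := by
  refine ⟨fun U hU ⟨z, hz⟩ => ?_⟩
  rw [arcLength_apply hU.measurableSet]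
  obtain ⟨t, ht, rfl⟩ : ∃ t ∈ Ioc 0 (2 * Real.pi), Circle.exp t = z := by
    by_cases h : z = Circle.exp 0
    · exact ⟨2 * Real.pi, ⟨Real.two_pi_pos, le_rfl⟩, by rw [h, Circle.exp_two_pi, Circle.exp_zero]⟩
    · obtain ⟨t, ht, h⟩ := exists_pt_eq 0 1 h
      exact ⟨t, Ioo_subset_Ioc_self ht, by rw [← h, pt_one, zero_add]⟩
  have hV : Circle.exp ⁻¹' U ∈ 𝓝 t := (hU.preimage Circle.exp.continuous).mem_nhds hz
  obtain ⟨ε, hε, hball⟩ := Metric.mem_nhds_iff.1 hV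
  rw [Real.ball_eq_Ioo] at hball
  refine ne_of_gt (lt_of_lt_of_le ?_ (measure_mono (s := Ioo (max 0 (t - ε)) t) fun x hx => ?_))
  · rw [Real.volume_Ioo, ENNReal.ofReal_pos, sub_pos]
    exact max_lt ht.1 (by linarith)
  · exact ⟨hball ⟨(le_max_right _ _).trans_lt hx.1, by linarith [hx.2]⟩,
      (le_max_left _ _).trans_lt hx.1, hx.2.le.trans ht.2⟩

/-! ### Approximation in `L^∞` by polynomials in the generators -/

/-- The functions which are essentially uniform limits of polynomials in the generators. -/
def Approximable (g : Circle → ℝ) (S : Set Circle) (u : Circle → ℂ) : Prop :=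
  ∀ ε > 0, ∃ p ∈ polynomials g S, ∀ᵐ z ∂arcLength, ‖u z - p z‖ ≤ ε

lemma mem_closure_polynomialClasses_iff {g : Circle → ℝ} (hg : IsJumpFunction g) (S : Set Circle)
    (f : LInfty) : f ∈ closure (polynomialClasses g S) ↔ Approximable g S f := by
  rw [Metric.mem_closure_iff]
  constructor
  · intro h ε hε
    obtain ⟨b, ⟨p, hp, hbp⟩, hd⟩ := h ε hε
    refine ⟨p, hp, ?_⟩
    rw [dist_eq_norm] at hd
    have h1 : ∀ᵐ z ∂arcLength, ‖(f - b : LInfty) z‖ₑ ≤ eLpNormEssSup (f - b : LInfty) arcLength :=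
      enorm_ae_le_eLpNormEssSup _ _
    filter_upwards [h1, Lp.coeFn_sub f b, hbp] with z h1 h2 h3
    rw [h2, Pi.sub_apply, h3, ← eLpNorm_exponent_top, ← Lp.enorm_def, enorm_le_iff_norm_le] at h1
    exact h1.trans hd.le
  · intro h ε hε
    obtain ⟨p, hp, hfp⟩ := h (ε / 2) (half_pos hε)
    have hmem := memLp_of_mem_polynomials hg S hp
    refine ⟨hmem.toLp p, ⟨p, hp, hmem.coeFn_toLp⟩, ?_⟩
    have h1 : dist f (hmem.toLp p) ≤ ε / 2 := by
      rw [dist_eq_norm, Lp.norm_def, eLpNorm_exponent_top]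
      refine ENNReal.toReal_le_of_le_ofReal (half_pos hε).le (eLpNormEssSup_le_of_ae_bound ?_)
      filter_upwards [hfp, Lp.coeFn_sub f (hmem.toLp p), hmem.coeFn_toLp] with z h1 h2 h3
      rwa [h2, Pi.sub_apply, h3]
    linarith

namespace Approximable

variable {g : Circle → ℝ} {S : Set Circle} {u v : Circle → ℂ}

lemma of_mem (h : u ∈ polynomials g S) : Approximable g S u :=
  fun ε hε => ⟨u, h, Eventually.of_forall fun z => by simpa using hε.le⟩

lemma add (hu : Approximable g S u) (hv : Approximable g S v) :
    Approximable g S fun z => u z + v z := by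
  intro ε hε
  obtain ⟨p, hp, hup⟩ := hu (ε / 2) (half_pos hε)
  obtain ⟨q, hq, hvq⟩ := hv (ε / 2) (half_pos hε)
  refine ⟨p + q, add_mem hp hq, ?_⟩
  filter_upwards [hup, hvq] with z h1 h2
  rw [Pi.add_apply, add_sub_add_comm]
  exact (norm_add_le _ _).trans (by linarith)

lemma sum {ι : Type*} (s : Finset ι) {u : ι → Circle → ℂ} (h : ∀ i ∈ s, Approximable g S (u i)) :
    Approximable g S fun z => ∑ i ∈ s, u i z := by
  classical
  induction s using Finset.induction_on with
  | empty => exact of_mem (zero_mem _)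
  | insert i s hi ih =>
    simp_rw [Finset.sum_insert hi]
    exact (h i (Finset.mem_insert_self _ _)).add
      (ih fun j hj => h j (Finset.mem_insert_of_mem hj))

lemma exists_ae_bound (hg : IsJumpFunction g) (hu : Approximable g S u) :
    ∃ C > 0, ∀ᵐ z ∂arcLength, ‖u z‖ ≤ C := by
  obtain ⟨p, hp, hup⟩ := hu 1 one_pos
  have h2 := (memLp_of_mem_polynomials hg S hp).2
  rw [eLpNorm_exponent_top] at h2
  refine ⟨1 + (eLpNormEssSup p arcLength).toReal, by positivity, ?_⟩
  filter_upwards [hup, enorm_ae_le_eLpNormEssSup p arcLength] with z h1 h3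
  have h4 : ‖p z‖ ≤ (eLpNormEssSup p arcLength).toReal := by
    rw [← toReal_enorm]
    exact ENNReal.toReal_mono h2.ne h3
  linarith [norm_le_norm_add_norm_sub' (u z) (p z)]

lemma mul (hg : IsJumpFunction g) (hu : Approximable g S u) (hv : Approximable g S v) :
    Approximable g S fun z => u z * v z := by
  intro ε hε
  obtain ⟨C, hC, hCu⟩ := hu.exists_ae_bound hg
  obtain ⟨q, hq, hvq⟩ := hv (ε / 2 / C) (by positivity)
  obtain ⟨D, hD, hDq⟩ := (of_mem hq).exists_ae_bound hg
  obtain ⟨p, hp, hup⟩ := hu (ε / 2 / D) (by positivity)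
  refine ⟨p * q, mul_mem hp hq, ?_⟩
  filter_upwards [hCu, hvq, hDq, hup] with z h1 h2 h3 h4
  rw [Pi.mul_apply, show u z * v z - p z * q z = u z * (v z - q z) + (u z - p z) * q z by ring]
  refine (norm_add_le _ _).trans ?_
  rw [norm_mul, norm_mul]
  have e1 := mul_le_mul h1 h2 (norm_nonneg _) hC.le
  have e2 := mul_le_mul h4 h3 (norm_nonneg _) (by positivity)
  have e3 : C * (ε / 2 / C) = ε / 2 := by field_simp
  have e4 : ε / 2 / D * D = ε / 2 := by field_simp
  linarith

lemma of_forall_approx (h : ∀ ε > 0, ∃ v, Approximable g S v ∧ ∀ᵐ z ∂arcLength, ‖u z - v z‖ ≤ ε) :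
    Approximable g S u := by
  intro ε hε
  obtain ⟨v, hv, huv⟩ := h (ε / 2) (half_pos hε)
  obtain ⟨p, hp, hvp⟩ := hv (ε / 2) (half_pos hε)
  refine ⟨p, hp, ?_⟩
  filter_upwards [huv, hvp] with z h1 h2
  linarith [norm_sub_le_norm_sub_add_norm_sub (u z) (v z) (p z)]

end Approximable

/-! ### Limits of polynomials in the generators are almost periodic -/

/-- The function `u` behaves near every point of the circle, on each side of it, like a
trigonometric polynomial in the logarithm of the distance to the point. -/
def LocallyTrig (u : Circle → ℂ) : Prop :=
  ∀ (t₀ : ℝ) (k : ℤˣ), ∀ ε > 0, ∃ q ∈ trigPoly,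
    ∀ᶠ t in 𝓝[>] (0 : ℝ), ‖u (pt t₀ k t) - q (Real.log t)‖ < ε

lemma exists_trigPoly_of_tendsto {w : ℝ → ℂ} {c : ℂ} (h : Tendsto w (𝓝[>] 0) (𝓝 c)) {ε : ℝ}
    (hε : 0 < ε) : ∃ q ∈ trigPoly, ∀ᶠ t in 𝓝[>] (0 : ℝ), ‖w t - q (Real.log t)‖ < ε := by
  refine ⟨algebraMap ℂ _ c, trigPoly.algebraMap_mem c, ?_⟩
  filter_upwards [Metric.tendsto_nhds.1 h ε hε] with t ht
  rw [dist_eq_norm] at ht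
  simpa [Algebra.algebraMap_eq_smul_one] using ht

/-- For a function with a single discontinuity only the behaviour at that point matters. -/
lemma locallyTrig_of_continuousOn_compl {u : Circle → ℂ} (t₁ : ℝ)
    (hc : ContinuousOn u {Circle.exp t₁}ᶜ)
    (h : ∀ k : ℤˣ, ∀ ε > 0, ∃ q ∈ trigPoly,
      ∀ᶠ t in 𝓝[>] (0 : ℝ), ‖u (pt t₁ k t) - q (Real.log t)‖ < ε) : LocallyTrig u := by
  intro t₀ k ε hε
  by_cases h01 : Circle.exp t₀ = Circle.exp t₁
  · rw [pt_congr h01]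
    exact h k ε hε
  · refine exists_trigPoly_of_tendsto (c := u (Circle.exp t₀)) ?_ hε
    have h1 : ContinuousAt u (pt t₀ k 0) := by
      rw [pt_zero]
      exact hc.continuousAt (isOpen_compl_singleton.mem_nhds h01)
    rw [← pt_zero t₀ k]
    exact (h1.tendsto.comp (continuous_pt t₀ k).continuousAt.tendsto).mono_left
      nhdsWithin_le_nhds

lemma Ioo_two_pi_mem_nhdsGT : Ioo 0 (2 * Real.pi) ∈ 𝓝[>] (0 : ℝ) :=
  Ioo_mem_nhdsGT Real.two_pi_pos

lemma tendsto_two_pi_sub :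
    Tendsto (fun t : ℝ => 2 * Real.pi - t) (𝓝[>] 0) (𝓝[<] (2 * Real.pi)) := by
  refine tendsto_nhdsWithin_iff.2 ⟨?_, ?_⟩
  · have : Tendsto (fun t : ℝ => 2 * Real.pi - t) (𝓝 0) (𝓝 (2 * Real.pi - 0)) :=
      (continuous_const.sub continuous_id).tendsto 0
    rw [sub_zero] at this
    exact this.mono_left nhdsWithin_le_nhds
  · filter_upwards [self_mem_nhdsWithin] with t ht
    simpa using ht

lemma locallyTrig_jumpAt {g : Circle → ℝ} (hg : IsJumpFunction g) (t₁ : ℝ) :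
    LocallyTrig fun z => (jumpAt g t₁ z : ℂ) := by
  refine locallyTrig_of_continuousOn_compl t₁
    (Complex.continuous_ofReal.comp_continuousOn (continuousOn_jumpAt hg t₁)) fun k ε hε => ?_
  rcases Int.units_eq_one_or k with rfl | rfl
  · refine exists_trigPoly_of_tendsto (c := ((1 : ℝ) : ℂ)) ?_ hε
    simp_rw [jumpAt_pt_one]
    exact (Complex.continuous_ofReal.tendsto _).comp hg.tendsto_zero
  · refine exists_trigPoly_of_tendsto (c := ((0 : ℝ) : ℂ)) ?_ hε
    simp_rw [pt_neg, jumpAt_pt_one]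
    exact (Complex.continuous_ofReal.tendsto _).comp (hg.tendsto_two_pi.comp tendsto_two_pi_sub)

lemma locallyTrig_expLogAt (lam t₁ : ℝ) (k₁ : ℤˣ) : LocallyTrig (expLogAt lam t₁ k₁) := by
  refine locallyTrig_of_continuousOn_compl t₁ (continuousOn_expLogAt lam t₁ k₁) fun k ε hε => ?_
  by_cases hk : k = k₁
  · subst hk
    refine ⟨chi lam, chi_mem_trigPoly lam, ?_⟩
    filter_upwards [Ioo_two_pi_mem_nhdsGT] with t ht
    rw [expLogAt_eq, logAt_pt t₁ k ht, sub_self, norm_zero]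
    exact hε
  · obtain rfl : k = -k₁ := by
      rcases Int.units_eq_one_or k with rfl | rfl <;> rcases Int.units_eq_one_or k₁ with rfl | rfl
      all_goals simp_all
    refine exists_trigPoly_of_tendsto (c := chi lam (Real.log (2 * Real.pi))) ?_ hε
    have h1 : Tendsto (fun t : ℝ => chi lam (Real.log (2 * Real.pi - t))) (𝓝[>] 0)
        (𝓝 (chi lam (Real.log (2 * Real.pi)))) :=
      ((chi lam).continuous.tendsto _).comp
        ((Real.continuousAt_log Real.two_pi_pos.ne').tendsto.comp
          (tendsto_two_pi_sub.mono_right nhdsWithin_le_nhds))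
    refine h1.congr' ?_
    filter_upwards [Ioo_two_pi_mem_nhdsGT] with t ht
    rw [expLogAt_eq, pt_neg, logAt_pt t₁ k₁ ⟨by linarith [ht.2], by linarith [ht.1]⟩]

lemma locallyTrig_of_mem_polynomials {g : Circle → ℝ} (hg : IsJumpFunction g) {S : Set Circle}
    {p : Circle → ℂ} (hp : p ∈ polynomials g S) : LocallyTrig p := by
  induction hp using Algebra.adjoin_induction with
  | mem u hu =>
    obtain ⟨t₁, -, rfl | ⟨lam, k, rfl⟩⟩ := hu
    · exact locallyTrig_jumpAt hg t₁
    · exact locallyTrig_expLogAt lam t₁ k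
  | algebraMap r =>
    exact fun t₀ k ε hε => exists_trigPoly_of_tendsto (c := r) tendsto_const_nhds hε
  | add u v _ _ hu hv =>
    intro t₀ k ε hε
    obtain ⟨q, hq, huq⟩ := hu t₀ k (ε / 2) (half_pos hε)
    obtain ⟨r, hr, hvr⟩ := hv t₀ k (ε / 2) (half_pos hε)
    refine ⟨q + r, trigPoly.add_mem hq hr, ?_⟩
    filter_upwards [huq, hvr] with t h1 h2
    rw [Pi.add_apply, BoundedContinuousFunction.add_apply, add_sub_add_comm]
    exact (norm_add_le _ _).trans_lt (by linarith)
  | mul u v _ _ hu hv =>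
    intro t₀ k ε hε
    obtain ⟨q₁, -, huq₁⟩ := hu t₀ k 1 one_pos
    set C := ‖q₁‖ + 1 with hC
    have hC0 : 0 < C := by positivity
    obtain ⟨r, hr, hvr⟩ := hv t₀ k (ε / 2 / C) (by positivity)
    set D := ‖r‖ + 1 with hD
    have hD0 : 0 < D := by positivity
    obtain ⟨q, hq, huq⟩ := hu t₀ k (ε / 2 / D) (by positivity)
    refine ⟨q * r, trigPoly.mul_mem hq hr, ?_⟩
    filter_upwards [huq₁, hvr, huq] with t h1 h2 h3
    have e1 : ‖u (pt t₀ k t)‖ ≤ C := by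
      linarith [norm_le_norm_add_norm_sub' (u (pt t₀ k t)) (q₁ (Real.log t)),
        q₁.norm_coe_le_norm (Real.log t)]
    have e2 : ‖r (Real.log t)‖ < D := by linarith [r.norm_coe_le_norm (Real.log t)]
    have e3 := mul_le_mul e1 h2.le (norm_nonneg _) hC0.le
    have e4 := mul_lt_mul_of_le_of_lt_of_nonneg_of_pos h3.le e2 (norm_nonneg _)
      (by positivity : 0 < ε / 2 / D)
    have e5 : C * (ε / 2 / C) = ε / 2 := by field_simp
    have e6 : ε / 2 / D * D = ε / 2 := by field_simp
    rw [Pi.mul_apply, BoundedContinuousFunction.mul_apply,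
      show u (pt t₀ k t) * v (pt t₀ k t) - q (Real.log t) * r (Real.log t) =
        u (pt t₀ k t) * (v (pt t₀ k t) - r (Real.log t)) +
          (u (pt t₀ k t) - q (Real.log t)) * r (Real.log t) by ring]
    refine (norm_add_le _ _).trans_lt ?_
    rw [norm_mul, norm_mul]
    linarith

lemma continuousOn_of_mem_polynomials {g : Circle → ℝ} (hg : IsJumpFunction g) {S : Set Circle}
    {p : Circle → ℂ} (hp : p ∈ polynomials g S) : ContinuousOn p Sᶜ := by
  induction hp using Algebra.adjoin_induction with
  | mem u hu =>
    obtain ⟨t₁, h₁, hu⟩ := hu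
    have hsub : Sᶜ ⊆ {Circle.exp t₁}ᶜ := compl_subset_compl.2 (singleton_subset_iff.2 h₁)
    obtain rfl | ⟨lam, k, rfl⟩ := hu
    · exact (Complex.continuous_ofReal.comp_continuousOn (continuousOn_jumpAt hg t₁)).mono hsub
    · exact (continuousOn_expLogAt lam t₁ k).mono hsub
  | algebraMap r => exact continuousOn_const
  | add u v _ _ hu hv => exact hu.add hv
  | mul u v _ _ hu hv => exact hu.mul hv

lemma mem_APCircle_of_approximable {g : Circle → ℝ} (hg : IsJumpFunction g) {S : Set Circle}
    {f : LInfty} (hf : Approximable g S f) : f ∈ APCircle := by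
  intro t₀ ε hε
  obtain ⟨p, hp, hfp⟩ := hf (ε / 4) (by positivity)
  choose q hq hpq using fun k : ℤˣ =>
    locallyTrig_of_mem_polynomials hg hp t₀ k (ε / 4) (by positivity)
  obtain ⟨s', hs'0, hs'⟩ := mem_nhdsGT_iff_exists_Ioo_subset.1 (eventually_all.2 hpq)
  have hpi := Real.pi_pos
  set s := min s' (Real.pi / 2) with hs
  have hs0 : 0 < s := lt_min hs'0 (by positivity)
  have hspi : s < Real.pi := (min_le_right _ _).trans_lt (by linarith)
  refine ⟨s, ⟨hs0, hspi⟩, fun k => ⟨fun z => q k (logAt t₀ k z), ⟨?_, ?_⟩, ?_⟩⟩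
  · exact (q k).continuous.comp_continuousOn
      ((continuousOn_logAt t₀ k).mono (arc_subset_compl t₀ k (by linarith)))
  · refine ⟨translate (Real.log s) (q k),
      isAlmostPeriodic_of_mem_trigPoly (translate_mem_trigPoly _ (hq k)), fun t ht => ?_⟩
    have h1 : s * Real.exp t < s := by
      simpa using mul_lt_mul_of_pos_left ((Real.exp_lt_exp.2 ht).trans_eq Real.exp_zero) hs0
    simp only
    rw [logAt_pt t₀ k ⟨by positivity, by linarith⟩, translate_apply,
      Real.log_mul hs0.ne' (Real.exp_pos t).ne', Real.log_exp]
  · refine lt_of_le_of_lt (eLpNormEssSup_le_of_ae_bound (C := ε / 2) ?_)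
      ((ENNReal.ofReal_lt_ofReal_iff hε).2 (by linarith))
    filter_upwards [ae_restrict_of_ae hfp, ae_restrict_mem (isOpen_arc t₀ k s).measurableSet]
      with z h1 hz
    obtain ⟨t, ht, rfl⟩ := hz
    have h2 := hs' ⟨ht.1, ht.2.trans_le (min_le_left _ _)⟩ k
    rw [logAt_pt t₀ k ⟨ht.1, by linarith [ht.2]⟩]
    linarith [norm_sub_le_norm_sub_add_norm_sub (f (pt t₀ k t)) (p (pt t₀ k t)) (q k (Real.log t))]

/-- Essentially uniform limits of polynomials in the generators are continuous off `S`. As arc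
length charges every nonempty open set, the limit is uniform off `S` without exceptions. -/
lemma exists_continuousOn_of_approximable {g : Circle → ℝ} (hg : IsJumpFunction g) {S : Set Circle}
    (hS : IsClosed S) {f : Circle → ℂ} (hf : Approximable g S f) :
    ∃ F : Circle → ℂ, ContinuousOn F Sᶜ ∧ f =ᵐ[arcLength] F := by
  classical
  choose p hp hfp using fun n : ℕ => hf (1 / ((n : ℝ) + 1)) (by positivity)
  have hc := fun n => continuousOn_of_mem_polynomials hg (hp n)
  have hdist : ∀ m n, ∀ z ∈ Sᶜ, ‖p m z - p n z‖ ≤ 1 / ((m : ℝ) + 1) + 1 / ((n : ℝ) + 1) := by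
    intro m n z hz
    by_contra! hlt
    have hopen : IsOpen (Sᶜ ∩ (fun z => ‖p m z - p n z‖) ⁻¹'
        Ioi (1 / ((m : ℝ) + 1) + 1 / ((n : ℝ) + 1))) :=
      ((hc m).sub (hc n)).norm.isOpen_inter_preimage hS.isOpen_compl isOpen_Ioi
    refine (hopen.measure_pos arcLength ⟨z, hz, hlt⟩).ne' (measure_mono_null ?_
      (ae_iff.1 ((hfp m).and (hfp n))))
    rintro w ⟨-, hw⟩ ⟨h1, h2⟩
    rw [norm_sub_rev] at h1
    have := norm_sub_le_norm_sub_add_norm_sub (p m w) (f w) (p n w)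
    simp only [mem_preimage, mem_Ioi] at hw
    linarith
  have hsmall : ∀ ε > 0, ∃ N : ℕ, ∀ n ≥ N, 1 / ((n : ℝ) + 1) < ε := fun ε hε =>
    eventually_atTop.1 (tendsto_one_div_add_atTop_nhds_zero_nat.eventually_lt_const hε)
  have hcauchy : UniformCauchySeqOn p atTop Sᶜ := by
    rw [Metric.uniformCauchySeqOn_iff]
    intro ε hε
    obtain ⟨N, hN⟩ := hsmall (ε / 2) (half_pos hε)
    refine ⟨N, fun m hm n hn z hz => ?_⟩
    rw [dist_eq_norm]
    linarith [hdist m n z hz, hN m hm, hN n hn]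
  have hlim : ∀ z ∈ Sᶜ, Tendsto (fun n => p n z) atTop (𝓝 (limUnder atTop fun n => p n z)) :=
    fun z hz => (hcauchy.cauchySeq hz).tendsto_limUnder
  refine ⟨S.piecewise f fun z => limUnder atTop fun n => p n z, ?_, ?_⟩
  · refine ContinuousOn.congr (f := fun z => limUnder atTop fun n => p n z) ?_
      (S.piecewise_eqOn_compl _ _)
    exact (hcauchy.tendstoUniformlyOn_of_tendsto hlim).continuousOn
      (Eventually.of_forall hc).frequently
  · filter_upwards [ae_all_iff.2 hfp] with z hz
    by_cases hzS : z ∈ S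
    · rw [S.piecewise_eq_of_mem _ _ hzS]
    · rw [S.piecewise_eq_of_notMem _ _ hzS]
      refine tendsto_nhds_unique ?_ (hlim z hzS)
      rw [tendsto_iff_norm_sub_tendsto_zero]
      refine squeeze_zero (fun _ => norm_nonneg _) (fun n => ?_)
        tendsto_one_div_add_atTop_nhds_zero_nat
      rw [norm_sub_rev]
      exact hz n

/-! ### Almost periodic functions are limits of polynomials in the generators -/

/-- In the coordinate of the arc `(0, 2π)` the jump function extends to an injective continuous
function on `[0, 2π]`. -/
lemma IsJumpFunction.exists_extension {g : Circle → ℝ} (hg : IsJumpFunction g) :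
    ∃ G : ℝ → ℝ, ContinuousOn G (Icc 0 (2 * Real.pi)) ∧ InjOn G (Icc 0 (2 * Real.pi)) ∧
      ∀ t ∈ Ioo 0 (2 * Real.pi), G t = g (Circle.exp t) := by
  set γ : ℝ → ℝ := fun t => g (Circle.exp t) with hγ
  have hpi := Real.two_pi_pos
  have hcont : ContinuousOn γ (Ioo 0 (2 * Real.pi)) := by
    refine hg.continuousOn.comp Circle.exp.continuous.continuousOn fun t ht => ?_
    have := pt_ne 0 1 ht
    rwa [pt_one, zero_add, Circle.exp_zero] at this
  set G := extendFrom (Ioo 0 (2 * Real.pi)) γ with hG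
  have hGc : ContinuousOn G (Icc 0 (2 * Real.pi)) :=
    continuousOn_Icc_extendFrom_Ioo hcont hg.tendsto_zero hg.tendsto_two_pi
  have hGγ : ∀ t ∈ Ioo 0 (2 * Real.pi), G t = γ t := fun t ht =>
    extendFrom_eq (subset_closure ht) (hcont t ht)
  refine ⟨G, hGc, StrictAntiOn.injOn ?_, hGγ⟩
  have hanti : StrictAntiOn G (Ioo 0 (2 * Real.pi)) := fun s hs t ht hst => by
    rw [hGγ s hs, hGγ t ht]
    exact hg.strictAntiOn hs ht hst
  have hle : AntitoneOn G (Icc 0 (2 * Real.pi)) := by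
    intro s hs t ht hst
    -- both points are moved into the open interval by contracting it slightly towards `π`
    have hmem : ∀ x ∈ Icc 0 (2 * Real.pi), ∀ᶠ l in 𝓝[>] (0 : ℝ),
        x + l * (Real.pi - x) ∈ Ioo 0 (2 * Real.pi) := fun x hx => by
      filter_upwards [Ioo_mem_nhdsGT one_pos] with l hl
      constructor <;> nlinarith [hl.1, hl.2, hx.1, hx.2, mul_nonneg hl.1.le hx.1]
    have hlim : ∀ x ∈ Icc 0 (2 * Real.pi),
        Tendsto (fun l => G (x + l * (Real.pi - x))) (𝓝[>] 0) (𝓝 (G x)) := fun x hx => by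
      refine (hGc x hx).tendsto.comp (tendsto_nhdsWithin_iff.2
        ⟨?_, (hmem x hx).mono fun l hl => Ioo_subset_Icc_self hl⟩)
      have h1 : Continuous fun l : ℝ => x + l * (Real.pi - x) := by fun_prop
      have h2 := h1.tendsto 0
      rw [zero_mul, add_zero] at h2
      exact h2.mono_left nhdsWithin_le_nhds
    refine le_of_tendsto_of_tendsto (hlim t ht) (hlim s hs) ?_
    filter_upwards [hmem s hs, hmem t ht, Ioo_mem_nhdsGT one_pos] with l h1 h2 hl
    exact hanti.antitoneOn h1 h2 (by nlinarith [hl.2])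
  intro s hs t ht hst
  -- two intermediate points, where the function is strictly decreasing
  obtain ⟨a, hsa, hat⟩ := exists_between hst
  obtain ⟨b, hab, hbt⟩ := exists_between hat
  have ha : a ∈ Ioo 0 (2 * Real.pi) := ⟨hs.1.trans_lt hsa, hat.trans_le ht.2⟩
  have hb : b ∈ Ioo 0 (2 * Real.pi) := ⟨ha.1.trans hab, hbt.trans_le ht.2⟩
  calc G t ≤ G b := hle (Ioo_subset_Icc_self hb) ht hbt.le
    _ < G a := hanti ha hb hab
    _ ≤ G s := hle hs (Ioo_subset_Icc_self ha) hsa.le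

/-- A function with one-sided limits at one point of `S` and continuous elsewhere is a limit of
polynomials in the jump function at that point, by the Stone–Weierstrass theorem. -/
lemma approximable_of_comp_pt_one {g : Circle → ℝ} (hg : IsJumpFunction g) {S : Set Circle} {t₀ : ℝ}
    (h₀ : Circle.exp t₀ ∈ S) {u : Circle → ℂ} {w : ℝ → ℂ}
    (hw : ContinuousOn w (Icc 0 (2 * Real.pi)))
    (huw : ∀ t ∈ Ioo 0 (2 * Real.pi), u (pt t₀ 1 t) = w t) : Approximable g S u := by
  obtain ⟨G, hGc, hGi, hG⟩ := hg.exists_extension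
  set I := Icc 0 (2 * Real.pi) with hI
  let Gc : C(I, ℂ) := ⟨fun t => (G t : ℂ),
    Complex.continuous_ofReal.comp (continuousOn_iff_continuous_domRestrict.1 hGc)⟩
  let wc : C(I, ℂ) := ⟨fun t => w t, continuousOn_iff_continuous_domRestrict.1 hw⟩
  have hstar : star Gc = Gc := by
    ext t
    simp [Gc]
  have hsep : (StarAlgebra.adjoin ℂ {Gc}).SeparatesPoints := by
    intro s t hst
    refine ⟨Gc, ⟨Gc, StarAlgebra.subset_adjoin ℂ _ rfl, rfl⟩, fun h => hst ?_⟩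
    exact Subtype.ext (hGi s.2 t.2 (Complex.ofReal_injective h))
  have hdense := ContinuousMap.starSubalgebra_topologicalClosure_eq_top_of_separatesPoints _ hsep
  -- polynomials in `Gc` are polynomials in the generators
  have hpoly : ∀ q ∈ Algebra.adjoin ℂ {Gc}, ∃ p ∈ polynomials g S,
      ∀ t (ht : t ∈ Ioo 0 (2 * Real.pi)), p (pt t₀ 1 t) = q ⟨t, Ioo_subset_Icc_self ht⟩ := by
    intro q hq
    induction hq using Algebra.adjoin_induction with
    | mem q hq =>
      obtain rfl : q = Gc := hq
      refine ⟨fun z => (jumpAt g t₀ z : ℂ), Algebra.subset_adjoin ⟨t₀, h₀, Or.inl rfl⟩,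
        fun t ht => ?_⟩
      change (jumpAt g t₀ (pt t₀ 1 t) : ℂ) = (G t : ℂ)
      rw [jumpAt_pt_one, hG t ht]
    | algebraMap r => exact ⟨algebraMap ℂ _ r, algebraMap_mem _ r, fun t ht => rfl⟩
    | add q r _ _ hq hr =>
      obtain ⟨p, hp, hpq⟩ := hq
      obtain ⟨p', hp', hpr⟩ := hr
      exact ⟨p + p', add_mem hp hp', fun t ht => by simp [hpq t ht, hpr t ht]⟩
    | mul q r _ _ hq hr =>
      obtain ⟨p, hp, hpq⟩ := hq
      obtain ⟨p', hp', hpr⟩ := hr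
      exact ⟨p * p', mul_mem hp hp', fun t ht => by simp [hpq t ht, hpr t ht]⟩
  intro ε hε
  have hwmem : wc ∈
      closure ((StarAlgebra.adjoin ℂ {Gc} : StarSubalgebra ℂ C(I, ℂ)) : Set C(I, ℂ)) := by
    rw [← StarSubalgebra.topologicalClosure_coe, hdense]
    trivial
  obtain ⟨q, hq, hwq⟩ := Metric.mem_closure_iff.1 hwmem ε hε
  have hq' : q ∈ Algebra.adjoin ℂ {Gc} := by
    have h1 : q ∈ Algebra.adjoin ℂ ({Gc} ∪ star {Gc}) := hq
    rwa [Set.star_singleton, hstar, union_self] at h1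
  obtain ⟨p, hp, hpq⟩ := hpoly q hq'
  refine ⟨p, hp, ?_⟩
  have hne : ∀ᵐ z ∂arcLength, z ≠ Circle.exp t₀ := by
    rw [ae_iff]
    simp
  filter_upwards [hne] with z hz
  obtain ⟨t, ht, rfl⟩ := exists_pt_eq t₀ 1 hz
  rw [huw t ht, hpq t ht, ← dist_eq_norm]
  exact (ContinuousMap.dist_apply_le_dist (f := wc) (g := q)
    ⟨t, Ioo_subset_Icc_self ht⟩).trans hwq.le

lemma approximable_of_comp_pt {g : Circle → ℝ} (hg : IsJumpFunction g) {S : Set Circle} {t₀ : ℝ}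
    (h₀ : Circle.exp t₀ ∈ S) (k : ℤˣ) {u : Circle → ℂ} {w : ℝ → ℂ}
    (hw : ContinuousOn w (Icc 0 (2 * Real.pi)))
    (huw : ∀ t ∈ Ioo 0 (2 * Real.pi), u (pt t₀ k t) = w t) : Approximable g S u := by
  rcases Int.units_eq_one_or k with rfl | rfl
  · exact approximable_of_comp_pt_one hg h₀ hw huw
  · refine approximable_of_comp_pt_one hg h₀ (w := fun t => w (2 * Real.pi - t)) ?_ fun t ht => ?_
    · exact hw.comp (by fun_prop) fun t ht => ⟨by linarith [ht.2], by linarith [ht.1]⟩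
    · rw [← huw _ ⟨by linarith [ht.2], by linarith [ht.1]⟩, pt_neg, sub_sub_cancel]

lemma approximable_of_continuous {g : Circle → ℝ} (hg : IsJumpFunction g) {S : Set Circle}
    (hne : S.Nonempty) {u : Circle → ℂ} (hu : Continuous u) : Approximable g S u := by
  obtain ⟨z, hz⟩ := hne
  rw [← Circle.exp_arg z] at hz
  exact approximable_of_comp_pt_one hg hz (hu.comp (continuous_pt _ 1)).continuousOn fun t _ => rfl

lemma comp_logAt_mem_polynomials (g : Circle → ℝ) {S : Set Circle} {t₀ : ℝ}
    (h₀ : Circle.exp t₀ ∈ S) (k : ℤˣ) {q : BoundedContinuousFunction ℝ ℂ} (hq : q ∈ trigPoly) :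
    (fun z => q (logAt t₀ k z)) ∈ polynomials g S := by
  induction hq using Algebra.adjoin_induction with
  | mem q hq =>
    obtain ⟨lam, rfl⟩ := hq
    exact Algebra.subset_adjoin ⟨t₀, h₀, Or.inr ⟨lam, k, rfl⟩⟩
  | algebraMap r => exact algebraMap_mem (polynomials g S) r
  | add q r _ _ hq hr => exact add_mem hq hr
  | mul q r _ _ hq hr => exact mul_mem hq hr

/-- A continuous cutoff function, equal to `1` up to `π / 2` and to `0` from `π` on. -/
noncomputable def cutoff (t : ℝ) : ℝ := max 0 (min 1 (2 - 2 * t / Real.pi))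

lemma continuous_cutoff : Continuous cutoff := by
  unfold cutoff
  fun_prop

lemma cutoff_of_le {t : ℝ} (ht : t ≤ Real.pi / 2) : cutoff t = 1 := by
  have hpi := Real.pi_pos
  have h : 2 * t / Real.pi ≤ 1 := by rw [div_le_one hpi]; linarith
  rw [cutoff, min_eq_left (by linarith), max_eq_right zero_le_one]

lemma cutoff_of_ge {t : ℝ} (ht : Real.pi ≤ t) : cutoff t = 0 := by
  have hpi := Real.pi_pos
  have h : 2 ≤ 2 * t / Real.pi := by rw [le_div_iff₀ hpi]; linarith
  exact max_eq_left ((min_le_right _ _).trans (by linarith))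

/-- The cutoff function on the `k`-side of the point `e^{it₀}`. -/
noncomputable def cutoffAt (t₀ : ℝ) (k : ℤˣ) (z : Circle) : ℂ :=
  (cutoff (Real.exp (logAt t₀ k z)) : ℂ)

lemma cutoffAt_pt (t₀ : ℝ) (k : ℤˣ) {t : ℝ} (ht : t ∈ Ioo 0 (2 * Real.pi)) :
    cutoffAt t₀ k (pt t₀ k t) = cutoff t := by
  rw [cutoffAt, logAt_pt t₀ k ht, Real.exp_log ht.1]

lemma cutoffAt_pt_self (t₀ : ℝ) (k : ℤˣ) {t : ℝ} (ht : t ∈ Ioo 0 (Real.pi / 2)) :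
    cutoffAt t₀ k (pt t₀ k t) = 1 := by
  rw [cutoffAt_pt t₀ k ⟨ht.1, by linarith [ht.2, Real.pi_pos]⟩, cutoff_of_le ht.2.le,
    Complex.ofReal_one]

lemma cutoffAt_pt_neg (t₀ : ℝ) (k : ℤˣ) {t : ℝ} (ht : t ∈ Ioo 0 (Real.pi / 2)) :
    cutoffAt t₀ k (pt t₀ (-k) t) = 0 := by
  have hpi := Real.pi_pos
  rw [pt_neg, cutoffAt_pt t₀ k ⟨by linarith [ht.2], by linarith [ht.1]⟩,
    cutoff_of_ge (by linarith [ht.2]), Complex.ofReal_zero]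

lemma approximable_cutoffAt {g : Circle → ℝ} (hg : IsJumpFunction g) {S : Set Circle} {t₀ : ℝ}
    (h₀ : Circle.exp t₀ ∈ S) (k : ℤˣ) : Approximable g S (cutoffAt t₀ k) :=
  approximable_of_comp_pt hg h₀ k (w := fun t => (cutoff t : ℂ))
    (Complex.continuous_ofReal.comp continuous_cutoff).continuousOn fun _ ht => cutoffAt_pt t₀ k ht

/-- Near a point of `S`, the one-sided almost periodic approximants of a function are replaced by
trigonometric polynomials in the two logarithms, and these are glued by the cutoff functions. -/
lemma exists_approximable_near_of_mem {g : Circle → ℝ} (hg : IsJumpFunction g) {S : Set Circle}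
    {f : LInfty} (hf : f ∈ APCircle) {z₀ : Circle} (hz₀ : z₀ ∈ S) {ε : ℝ} (hε : 0 < ε) :
    ∃ U : Set Circle, IsOpen U ∧ z₀ ∈ U ∧ ∃ u, Approximable g S u ∧
      ∀ᵐ z ∂arcLength, z ∈ U → ‖f z - u z‖ ≤ ε := by
  obtain ⟨t₀, rfl⟩ : ∃ t₀, Circle.exp t₀ = z₀ := ⟨_, Circle.exp_arg z₀⟩
  obtain ⟨s, hs, h⟩ := hf t₀ (ε / 2) (half_pos hε)
  choose F hF hfF using h
  choose h hAP hFh using fun k => (hF k).2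
  choose q hq hhq using fun k => (hAP k).exists_trigPoly (half_pos hε)
  have hpi := Real.pi_pos
  set r := min s (Real.pi / 2) with hr
  have hr0 : 0 < r := lt_min hs.1 (by positivity)
  refine ⟨pt t₀ 1 '' Ioo (-r) r, isOpenMap_pt t₀ 1 _ isOpen_Ioo,
    ⟨0, ⟨by linarith, hr0⟩, pt_zero _ _⟩,
    fun z => ∑ k : ℤˣ, cutoffAt t₀ k z * translate (-Real.log s) (q k) (logAt t₀ k z), ?_, ?_⟩
  · exact Approximable.sum _ fun k _ => (approximable_cutoffAt hg hz₀ k).mul hg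
      (Approximable.of_mem (comp_logAt_mem_polynomials g hz₀ k (translate_mem_trigPoly _ (hq k))))
  · have hae : ∀ᵐ z ∂arcLength, ∀ k, z ∈ arc t₀ k s → ‖f z - F k z‖ ≤ ε / 2 := by
      rw [ae_all_iff]
      intro k
      rw [← ae_restrict_iff' (isOpen_arc t₀ k s).measurableSet]
      filter_upwards [ae_lt_of_essSup_lt (hfF k)] with z hz
      rw [← ofReal_norm, ENNReal.ofReal_lt_ofReal_iff (half_pos hε)] at hz
      exact hz.le
    have hne : ∀ᵐ z ∂arcLength, z ≠ Circle.exp t₀ := by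
      rw [ae_iff]
      simp
    filter_upwards [hae, hne] with z hz hz0 hzU
    obtain ⟨k, t, ht, rfl⟩ : ∃ (k : ℤˣ) (t : ℝ), t ∈ Ioo 0 r ∧ pt t₀ k t = z := by
      obtain ⟨t, ht, rfl⟩ := hzU
      rcases lt_trichotomy t 0 with h | rfl | h
      · exact ⟨-1, -t, ⟨by linarith, by linarith [ht.1]⟩, by simp [pt]⟩
      · exact absurd (pt_zero t₀ 1) hz0
      · exact ⟨1, t, ⟨h, ht.2⟩, rfl⟩
    have hts : t < s := ht.2.trans_le (min_le_left _ _)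
    have htpi : t ∈ Ioo 0 (Real.pi / 2) := ⟨ht.1, ht.2.trans_le (min_le_right _ _)⟩
    have hsum : ∑ j : ℤˣ, cutoffAt t₀ j (pt t₀ k t) *
        translate (-Real.log s) (q j) (logAt t₀ j (pt t₀ k t)) = q k (Real.log (t / s)) := by
      rw [Finset.sum_eq_single k]
      · rw [cutoffAt_pt_self t₀ k htpi, one_mul, logAt_pt t₀ k ⟨ht.1, by linarith [htpi.2]⟩,
          translate_apply, Real.log_div ht.1.ne' hs.1.ne', neg_add_eq_sub]
      · intro j _ hj
        obtain rfl : k = -j := by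
          rcases Int.units_eq_one_or k with rfl | rfl <;>
            rcases Int.units_eq_one_or j with rfl | rfl
          all_goals simp_all
        rw [cutoffAt_pt_neg t₀ j htpi, zero_mul]
      · exact fun hk => absurd (Finset.mem_univ k) hk
    rw [hsum]
    have h1 := hz k ⟨t, ⟨ht.1, hts⟩, rfl⟩
    have h2 := hFh k (Real.log (t / s)) (Real.log_neg (div_pos ht.1 hs.1) ((div_lt_one hs.1).2 hts))
    rw [Real.exp_log (div_pos ht.1 hs.1), mul_div_cancel₀ _ hs.1.ne'] at h2
    have h3 := hhq k (Real.log (t / s))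
    rw [← h2] at h3
    linarith [norm_sub_le_norm_sub_add_norm_sub (f (pt t₀ k t)) (F k (pt t₀ k t))
      (q k (Real.log (t / s)))]

/-- Off `S` a constant is a good local approximant, by continuity. -/
lemma exists_approximable_near {g : Circle → ℝ} (hg : IsJumpFunction g) {S : Set Circle}
    (hS : IsClosed S) {f : LInfty} (hf : f ∈ AP S) (z₀ : Circle) {ε : ℝ} (hε : 0 < ε) :
    ∃ U : Set Circle, IsOpen U ∧ z₀ ∈ U ∧ ∃ u, Approximable g S u ∧
      ∀ᵐ z ∂arcLength, z ∈ U → ‖f z - u z‖ ≤ ε := by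
  by_cases hz₀ : z₀ ∈ S
  · exact exists_approximable_near_of_mem hg hf.1 hz₀ hε
  · obtain ⟨F, hF, hfF⟩ := hf.2
    have h1 : ContinuousAt F z₀ := hF.continuousAt (hS.isOpen_compl.mem_nhds hz₀)
    obtain ⟨U, hU, hUo, hzU⟩ := mem_nhds_iff.1 (Metric.tendsto_nhds.1 h1.tendsto ε hε)
    refine ⟨U, hUo, hzU, fun _ => F z₀, .of_mem (algebraMap_mem (polynomials g S) (F z₀)), ?_⟩
    filter_upwards [hfF] with z hz hzU
    rw [hz, ← dist_eq_norm]
    exact (hU hzU).le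

lemma approximable_of_mem_AP {g : Circle → ℝ} (hg : IsJumpFunction g) {S : Set Circle}
    (hS : IsClosed S) (hne : S.Nonempty) {f : LInfty} (hf : f ∈ AP S) : Approximable g S f := by
  refine Approximable.of_forall_approx fun ε hε => ?_
  choose U hUo hzU u hu hfu using fun z₀ => exists_approximable_near hg hS hf z₀ hε
  obtain ⟨Z, hZ⟩ := isCompact_univ.elim_finite_subcover U hUo fun z _ => mem_iUnion.2 ⟨z, hzU z⟩
  obtain ⟨ρ, hρ⟩ := PartitionOfUnity.exists_isSubordinate isClosed_univ (fun z : Z => U z)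
    (fun z => hUo z) (by rwa [iUnion_subtype])
  refine ⟨fun z => ∑ i : Z, ((ρ i z : ℝ) : ℂ) * u i z, Approximable.sum _ fun i _ =>
    (approximable_of_continuous hg hne (Complex.continuous_ofReal.comp (ρ i).continuous)).mul hg
      (hu i), ?_⟩
  filter_upwards [ae_all_iff.2 fun i : Z => hfu i] with z hz
  have hsum : ∑ i : Z, ρ i z = 1 := by
    rw [← finsum_eq_sum_of_fintype]
    exact ρ.sum_eq_one (mem_univ z)
  have h1 : f z - ∑ i : Z, ((ρ i z : ℝ) : ℂ) * u i z =
      ∑ i : Z, ((ρ i z : ℝ) : ℂ) * (f z - u i z) := by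
    simp_rw [mul_sub]
    rw [Finset.sum_sub_distrib, ← Finset.sum_mul, ← Complex.ofReal_sum, hsum, Complex.ofReal_one,
      one_mul]
  rw [h1]
  calc ‖∑ i : Z, ((ρ i z : ℝ) : ℂ) * (f z - u i z)‖ ≤ ∑ i : Z, ρ i z * ε := by
        refine norm_sum_le_of_le _ fun i _ => ?_
        rw [norm_mul, Complex.norm_real, Real.norm_eq_abs, abs_of_nonneg (ρ.nonneg i z)]
        by_cases hi : z ∈ U i
        · exact mul_le_mul_of_nonneg_left (hz i hi) (ρ.nonneg i z)
        · have h0 : ρ i z = 0 := by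
            by_contra h0
            exact hi (hρ i (subset_tsupport _ h0))
          rw [h0, zero_mul, zero_mul]
    _ = ε := by rw [← Finset.sum_mul, hsum, one_mul]

end CircleAP

theorem mainTheorem5 (S : Set Circle) (hS : IsClosed S) (hne : S.Nonempty)
    (g : Circle → ℝ) (hg : CircleAP.IsJumpFunction g) :
    CircleAP.AP S = closure (CircleAP.polynomialClasses g S) := by
  ext f
  rw [CircleAP.mem_closure_polynomialClasses_iff hg]
  exact ⟨CircleAP.approximable_of_mem_AP hg hS hne, fun hf =>
    ⟨CircleAP.mem_APCircle_of_approximable hg hf,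
      CircleAP.exists_continuousOn_of_approximable hg hS hf⟩⟩
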